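/- Let $B,N_t,N_r,L\ge 1$ be integers and let $\mathcal X\subset\mathbb C$ be a constellation of size $2^M$ with unit average energy. In round $\ell$ of an INR-ARQ transmission, block $b=1,\dots,B$ is affected by an $N_r\times N_t$ fading matrix $H_{\ell,b}$; all entries of all these matrices are independent $\mathcal N_{\mathbb C}(0,1)$. For an $N_r\times N_t$ matrix $G$, let $I_{\mathcal X}(G)$ be the mutual information in bits between $x$ and $Gx+w$, where $x$ is uniform on $\mathcal X^{N_t}$ and $w$ has independent $\mathcal N_{\mathbb C}(0,1)$ entries and is independent of $x$. If round $\ell$ uses power $P_\ell$, put $I_\ell=\frac1B\sum_{b=1}^B I_{\mathcal X}\big(\sqrt{P_\ell/N_t}\,H_{\ell,b}\big)$ and $\bar I_\ell=I_1+\dots+I_\ell$. Let $0<R<MN_t$. In an ARQ system with $K$ feedback levels, the index $k_\ell=K-1$ (acknowledgment) is fed back after round $\ell$ if $\bar I_\ell\ge R$; otherwise the fed-back index is the $k_\ell\in\{0,\dots,K-2\}$ with $\theta([\mathbf k_{\ell-1},k_\ell])\le\bar I_\ell<\theta([\mathbf k_{\ell-1},k_\ell+1])$. Here $\mathbf k_{\ell-1}=[k_1,\dots,k_{\ell-1}]$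 and $\theta$ gives real quantization thresholds, which may depend on all previous feedback and satisfy $\theta([0])=0$ (for the first round), $\theta([\mathbf k,0])=\theta(\mathbf k)$ and $\theta([\mathbf k,0])<\dots<\theta([\mathbf k,K-2])$, with $\theta([\mathbf k,K-1])$ read as $\infty$. The power of round $\ell$ is a function $P_\ell(\mathbf k_{\ell-1})\ge0$ of the previous feedback and is $0$ after an acknowledgment. The system satisfies the long-term power constraint $P$ if $$\sum_{\ell=1}^{L}\ \sum_{\mathbf k\in\{0,\dots,K-1\}^{\ell-1}}\Pr(\mathbf k_{\ell-1}=\mathbf k)\,P_\ell(\mathbf k)\le P.$$ Its outage probability at round $\ell$ is $p(\ell)=\Pr(\bar I_\ell<R)$. Assume that $BR/M$ is not an integer and that $K\ge\lceil BR/M\rceil+1$. Put $$d^\dagger(R)=N_r\Big(1+\Big\lfloor B\Big(N_t-\frac RM\Big)\Big\rfloor\Big),\qquad d_\ell(R)=(1+BN_tN_r)^{\ell-1}\big(d^\dagger(R)+1\big)-1 .$$ Then $d_\ell(R)$ is the optimal outage diversity at every round $\ell=1,\dots,L$: if $p^*_\ell(P)$ denotes the infimum of $p(\ell)$ over all such systems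 (all thresholds and power rules) that satisfy the power constraint $P$, then $$\lim_{P\to\infty}\frac{-\log p^*_\ell(P)}{\log P}=d_\ell(R).$$ Moreover, there are thresholds, not depending on $P$, and for each $P>0$ a power rule satisfying the constraint $P$, such that the outage probabilities of the resulting systems satisfy $\lim_{P\to\infty}\frac{-\log p(\ell)}{\log P}=d_\ell(R)$ simultaneously for all $\ell=1,\dots,L$. -/

import Mathlib

open MeasureTheory ProbabilityTheory Filter Topology

noncomputable section

namespace INRARQ

/-! ## Mutual information of a MIMO channel with a discrete constellation -/

/-- Density at `y` of the output `G x + w` of the MIMO channel with gain matrix `G`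
and input vector `x`, the entries of `w` being independent `𝒩_ℂ(0,1)` variables. -/
def outputDensity {Nr Nt : ℕ} (G : Matrix (Fin Nr) (Fin Nt) ℂ) (x : Fin Nt → ℂ)
    (y : Fin Nr → ℂ) : ℝ :=
  (Real.pi ^ Nr)⁻¹ * Real.exp (-∑ r, ‖y r - G.mulVec x r‖ ^ 2)

/-- Density of the channel output when the input is uniformly distributed on `𝒳^Nt`. -/
def outputMarginal (𝒳 : Finset ℂ) {Nr Nt : ℕ} (G : Matrix (Fin Nr) (Fin Nt) ℂ)
    (y : Fin Nr → ℂ) : ℝ :=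
  ((𝒳.card : ℝ) ^ Nt)⁻¹ * ∑ x : Fin Nt → 𝒳, outputDensity G (fun t => (x t : ℂ)) y

/-- Input-output mutual information, in bits per channel use, of the channel
`y = G x + w` with input uniformly distributed on `𝒳^Nt`. -/
def mutualInfo (𝒳 : Finset ℂ) {Nr Nt : ℕ} (G : Matrix (Fin Nr) (Fin Nt) ℂ) : ℝ :=
  ((𝒳.card : ℝ) ^ Nt)⁻¹ * ∑ x : Fin Nt → 𝒳, ∫ y : Fin Nr → ℂ,
    outputDensity G (fun t => (x t : ℂ)) y *
      Real.logb 2 (outputDensity G (fun t => (x t : ℂ)) y / outputMarginal 𝒳 G y)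

/-! ## Block fading -/

/-- The circularly symmetric complex Gaussian law `𝒩_ℂ(0,1)`. -/
def stdComplexGaussian : Measure ℂ :=
  ((gaussianReal 0 (1 / 2)).prod (gaussianReal 0 (1 / 2))).map
    Complex.measurableEquivRealProd.symm

instance : IsProbabilityMeasure stdComplexGaussian :=
  Measure.isProbabilityMeasure_map Complex.measurableEquivRealProd.symm.measurable.aemeasurable

/-- The fading gains of one ARQ round: one `Nr × Nt` matrix for each of the `B` blocks. -/
abbrev RoundGain (B Nr Nt : ℕ) : Type := Fin B → Fin Nr → Fin Nt → ℂ

/-- All the gains of one round are independent `𝒩_ℂ(0,1)` variables. -/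
def roundLaw (B Nr Nt : ℕ) : Measure (RoundGain B Nr Nt) :=
  Measure.pi fun _ => Measure.pi fun _ => Measure.pi fun _ => stdComplexGaussian

instance (B Nr Nt : ℕ) : IsProbabilityMeasure (roundLaw B Nr Nt) := by
  unfold roundLaw; infer_instance

/-- Joint law of the fading gains: rounds `0, 1, 2, …` are independent. -/
def fadingLaw (B Nr Nt : ℕ) : Measure (ℕ → RoundGain B Nr Nt) :=
  Measure.infinitePi fun _ => roundLaw B Nr Nt

/-- Mutual information of one round used with transmit power `p`:
the average over the `B` blocks. -/
def roundInfo (𝒳 : Finset ℂ) {B Nr Nt : ℕ} (p : ℝ) (h : RoundGain B Nr Nt) : ℝ :=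
  (B : ℝ)⁻¹ * ∑ b, mutualInfo 𝒳 (((Real.sqrt (p / Nt) : ℝ) : ℂ) • Matrix.of (h b))

/-! ## Multi-level feedback and power adaptation

Feedback indices are elements of `Fin K`; a feedback vector collected over `n` rounds is
a function `Fin n → Fin K`, extended by one index with `Fin.snoc`. -/

/-- The index `K - 1`, which means positive acknowledgment. -/
def ack (K : ℕ) [NeZero K] : Fin K := ⟨K - 1, Nat.sub_lt (NeZero.pos K) one_pos⟩

/-- Quantization thresholds: `thr n fb k` is the threshold `Ī([fb, k])` used in the round
that follows the feedback vector `fb` of length `n`. Only the values at `k ≤ K - 2` matter. -/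
structure Quantizer (K : ℕ) where
  thr : (n : ℕ) → (Fin n → Fin K) → ℕ → ℝ
  thr_first : ∀ fb : Fin 0 → Fin K, thr 0 fb 0 = 0
  thr_snoc : ∀ (n : ℕ) (fb : Fin n → Fin K) (k : Fin K), (k : ℕ) + 1 < K →
    thr (n + 1) (Fin.snoc (α := fun _ => Fin K) fb k) 0 = thr n fb k
  thr_lt : ∀ (n : ℕ) (fb : Fin n → Fin K) (k : ℕ), k + 2 < K → thr n fb k < thr n fb (k + 1)

/-- A power adaptation rule: `power n fb` is the power of the round that follows the feedback
vector `fb` of length `n`. Nothing is transmitted after a positive acknowledgment. -/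
structure PowerRule (K : ℕ) [NeZero K] where
  power : (n : ℕ) → (Fin n → Fin K) → ℝ
  power_nonneg : ∀ n fb, 0 ≤ power n fb
  power_ack : ∀ (n : ℕ) (fb : Fin n → Fin K), (∃ i, fb i = ack K) → power n fb = 0

open Classical in
/-- The index fed back when the previous indices are `fb` and the accumulated mutual
information is `a`: the acknowledgment if `R ≤ a`; otherwise the index `k ≤ K - 2` with
`thr k ≤ a < thr (k + 1)`, where the threshold number `K - 1` counts as `∞`. -/
def feedbackIndex {K : ℕ} [NeZero K] (Q : Quantizer K) (R : ℝ) {n : ℕ} (fb : Fin n → Fin K)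
    (a : ℝ) : Fin K :=
  if R ≤ a then ack K
  else ⟨Nat.findGreatest (fun k => Q.thr n fb k ≤ a) (K - 2),
    lt_of_le_of_lt (Nat.findGreatest_le _)
      (Nat.sub_lt (NeZero.pos K) two_pos)⟩

section System

variable (𝒳 : Finset ℂ) {B Nr Nt K : ℕ} [NeZero K] (R : ℝ) (Q : Quantizer K) (S : PowerRule K)

/-- Feedback vector and accumulated mutual information after `n` rounds, for the fading
realization `h`. -/
def state (h : ℕ → RoundGain B Nr Nt) : (n : ℕ) → (Fin n → Fin K) × ℝ
  | 0 => (Fin.elim0, 0)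
  | n + 1 =>
    let fb := (state h n).1
    let a := (state h n).2 + roundInfo 𝒳 (S.power n fb) (h n)
    (Fin.snoc (α := fun _ => Fin K) fb (feedbackIndex Q R fb a), a)

/-- The feedback vector `[k_1, …, k_n]` after `n` rounds. -/
def feedback (h : ℕ → RoundGain B Nr Nt) (n : ℕ) : Fin n → Fin K := (state 𝒳 R Q S h n).1

/-- The mutual information accumulated over the first `n` rounds. -/
def accInfo (h : ℕ → RoundGain B Nr Nt) (n : ℕ) : ℝ := (state 𝒳 R Q S h n).2

variable (B Nr Nt)

/-- The probability `q(fb)` of the feedback vector `fb`. -/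
def feedbackProb {n : ℕ} (fb : Fin n → Fin K) : ℝ :=
  (fadingLaw B Nr Nt).real {h | feedback 𝒳 R Q S h n = fb}

/-- Average power spent on a codeword in at most `L` rounds. -/
def averagePower (L : ℕ) : ℝ :=
  ∑ n ∈ Finset.range L, ∑ fb : Fin n → Fin K, feedbackProb 𝒳 B Nr Nt R Q S fb * S.power n fb

/-- The outage probability `p(ℓ)` at round `ℓ`. -/
def outageProb (l : ℕ) : ℝ :=
  (fadingLaw B Nr Nt).real {h | accInfo 𝒳 R Q S h l < R}

end System

/-- The smallest outage probability at round `l` over all systems with `K` feedback levels and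
at most `L` rounds whose average power does not exceed `P`. -/
def optimalOutageProb (𝒳 : Finset ℂ) (B Nr Nt K : ℕ) [NeZero K] (R : ℝ) (L l : ℕ) (P : ℝ) : ℝ :=
  sInf {p : ℝ | ∃ (Q : Quantizer K) (S : PowerRule K),
    averagePower 𝒳 B Nr Nt R Q S L ≤ P ∧ p = outageProb 𝒳 B Nr Nt R Q S l}

/-- The Singleton-bound exponent `d†(R) = Nr (1 + ⌊B (Nt - R / M)⌋)`. -/
def singletonDiversity (B Nr Nt : ℕ) (M R : ℝ) : ℝ :=
  Nr * (1 + (⌊(B : ℝ) * (Nt - R / M)⌋ : ℝ))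

/-- `(1 + B Nt Nr)^(l - 1) (d†(R) + 1) - 1`, for rounds `l ≥ 1`. -/
def arqDiversity (B Nr Nt : ℕ) (M R : ℝ) (l : ℕ) : ℝ :=
  (1 + (B : ℝ) * Nt * Nr) ^ (l - 1) * (singletonDiversity B Nr Nt M R + 1) - 1

end INRARQ

end

/-!
After the feedback `fb`, which has probability `q fb`, the power constraint allows a power of at
most `P / q fb`, so the power exponent of a round is one more than the exponent of the probability
of its past. At power `p`, the information of one round stays below `i + 1` units of size `M / B` by
a fixed margin with probability of order `p ^ (-Nr * (B * Nt - i))`: up to a small error, a block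
loses `M` bits per dimension in which its matrix contracts the codeword differences, and each lost
dimension costs a factor `p ^ (-Nr)`. A round that conveys nothing thus multiplies the power
exponent by `1 + B * Nt * Nr`, while outage only requires the rounds together to stay within
`J = ⌊B * R / M⌋` units.

The converse follows the events where all rounds but the last convey nothing. For achievability,
the thresholds lie just below the multiples of `M / B`, so the feedback tells how many units have
arrived, and each power is the one that compensates the probability of its feedback; the
inequality `(1 + a + b + c) * (1 + c) ≤ (1 + a + c) * (1 + b + c)` shows that no splitting of the
`J` units over the rounds is worse than having them all arrive in the last one.
-/

noncomputable section

namespace INRARQ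

/-! ## Equivocation of a finite mixture -/

/-- The Chernoff coefficient `∫ f (g / f) ^ t = ∫ f ^ (1 - t) g ^ t` of two densities. It measures
how well they can be told apart; negative exponents `t` are allowed. -/
def chernoffCoeff {Y : Type*} [MeasurableSpace Y] (μ : Measure Y) (t : ℝ) (f g : Y → ℝ) : ℝ :=
  ∫ y, f y * (g y / f y) ^ t ∂μ

/-- The contribution of component `i` to the conditional entropy, in nats, of the component of a
uniform mixture given an observation with densities `f`; averaging over `i` gives that entropy. -/
def equivocation {Y ι : Type*} [MeasurableSpace Y] [Fintype ι] (μ : Measure Y) (f : ι → Y → ℝ)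
    (i : ι) : ℝ :=
  ∫ y, f i y * Real.log ((∑ j, f j y) / f i y) ∂μ

lemma sqrt_sum_le_sum_sqrt {κ : Type*} (s : Finset κ) {u : κ → ℝ} (hu : ∀ j ∈ s, 0 ≤ u j) :
    √(∑ j ∈ s, u j) ≤ ∑ j ∈ s, √(u j) := by
  rw [Real.sqrt_le_left (Finset.sum_nonneg fun _ _ => Real.sqrt_nonneg _)]
  calc ∑ j ∈ s, u j = ∑ j ∈ s, √(u j) ^ 2 :=
        Finset.sum_congr rfl fun j hj => (Real.sq_sqrt (hu j hj)).symm
    _ ≤ (∑ j ∈ s, √(u j)) ^ 2 :=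
        Finset.sum_sq_le_sq_sum_of_nonneg fun _ _ => Real.sqrt_nonneg _

lemma log_one_add_le_two_mul_sqrt {u : ℝ} (hu : 0 ≤ u) : Real.log (1 + u) ≤ 2 * √u := by
  have hlog : Real.log (1 + u) ≤ Real.log ((1 + √u) ^ 2) := by
    refine Real.log_le_log (by positivity) ?_
    nlinarith [Real.sq_sqrt hu, Real.sqrt_nonneg u]
  rw [Real.log_pow] at hlog
  have hsub := Real.log_le_sub_one_of_pos (show 0 < 1 + √u by positivity)
  push_cast at hlog
  linarith

lemma two_sub_two_mul_rpow_le_log {x : ℝ} (hx : 0 < x) :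
    2 - 2 * x ^ (-(1 / 2) : ℝ) ≤ Real.log x := by
  have h := Real.log_le_sub_one_of_pos (Real.rpow_pos_of_pos hx (-(1 / 2)))
  rw [Real.log_rpow hx] at h
  linarith

lemma integrable_mul_div_rpow_half {Y : Type*} [MeasurableSpace Y] {μ : Measure Y} {f g : Y → ℝ}
    (hfpos : ∀ y, 0 < f y) (hgpos : ∀ y, 0 < g y) (hf : Integrable f μ) (hg : Integrable g μ) :
    Integrable (fun y => f y * (g y / f y) ^ (1 / 2 : ℝ)) μ := by
  refine (hf.add hg).mono' ?_ (ae_of_all _ fun y => ?_)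
  · exact (hf.aemeasurable.mul
      ((hg.aemeasurable.div hf.aemeasurable).pow_const _)).aestronglyMeasurable
  · have hfy := hfpos y
    have hgy := hgpos y
    have hsqrt : √(g y / f y) ≤ 1 + g y / f y := by
      nlinarith [Real.sq_sqrt (div_pos hgy hfy).le, sq_nonneg (√(g y / f y) - 1)]
    rw [← Real.sqrt_eq_rpow, Real.norm_of_nonneg (by positivity)]
    calc f y * √(g y / f y) ≤ f y * (1 + g y / f y) := by gcongr
      _ = f y + g y := by field_simp

section Mixture

variable {Y ι : Type*} [Fintype ι] {f : ι → Y → ℝ}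

lemma self_le_sum_of_pos (hpos : ∀ j y, 0 < f j y) (i : ι) (y : Y) : f i y ≤ ∑ j, f j y :=
  Finset.single_le_sum (f := fun j => f j y) (fun j _ => (hpos j y).le) (Finset.mem_univ i)

lemma mul_log_sum_div_nonneg (hpos : ∀ j y, 0 < f j y) (i : ι) (y : Y) :
    0 ≤ f i y * Real.log ((∑ j, f j y) / f i y) :=
  mul_nonneg (hpos i y).le
    (Real.log_nonneg ((one_le_div (hpos i y)).2 (self_le_sum_of_pos hpos i y)))

lemma mul_log_sum_div_le_sum_sub (hpos : ∀ j y, 0 < f j y) (i : ι) (y : Y) :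
    f i y * Real.log ((∑ j, f j y) / f i y) ≤ ∑ j, f j y - f i y := by
  have hi := hpos i y
  have hsum : 0 < ∑ j, f j y := hi.trans_le (self_le_sum_of_pos hpos i y)
  calc f i y * Real.log ((∑ j, f j y) / f i y) ≤ f i y * ((∑ j, f j y) / f i y - 1) := by
        gcongr
        exact Real.log_le_sub_one_of_pos (by positivity)
    _ = ∑ j, f j y - f i y := by field_simp

lemma mul_log_sum_div_le [DecidableEq ι] (hpos : ∀ j y, 0 < f j y) {i : ι} {s : Finset ι}
    (hi : i ∈ s) (y : Y) :
    f i y * Real.log ((∑ j, f j y) / f i y) ≤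
      f i y * Real.log s.card + ((∑ j ∈ s, f j y) / s.card - f i y) +
        2 * ∑ j ∈ sᶜ, f i y * (f j y / f i y) ^ (1 / 2 : ℝ) := by
  have hfi : 0 < f i y := hpos i y
  have hs : (0 : ℝ) < s.card := by exact_mod_cast Finset.card_pos.2 ⟨i, hi⟩
  set near : ℝ := ∑ j ∈ s, f j y
  set far : ℝ := ∑ j ∈ sᶜ, f j y
  have hle : f i y ≤ near :=
    Finset.single_le_sum (f := fun j => f j y) (fun j _ => (hpos j y).le) hi
  have hnear : 0 < near := hfi.trans_le hle
  have hfar : 0 ≤ far := Finset.sum_nonneg fun j _ => (hpos j y).le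
  have hsplit : Real.log ((near + far) / f i y) =
      Real.log s.card + Real.log (near / (s.card * f i y)) + Real.log (1 + far / near) := by
    rw [← Real.log_mul (by positivity) (by positivity),
      ← Real.log_mul (by positivity) (by positivity)]
    congr 1
    field_simp
  have hlog_near : Real.log (near / (s.card * f i y)) ≤ near / (s.card * f i y) - 1 :=
    Real.log_le_sub_one_of_pos (by positivity)
  have hlog_far : Real.log (1 + far / near) ≤ 2 * ∑ j ∈ sᶜ, (f j y / f i y) ^ (1 / 2 : ℝ) :=
    calc Real.log (1 + far / near) ≤ 2 * √(far / near) :=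
          log_one_add_le_two_mul_sqrt (by positivity)
      _ ≤ 2 * √(∑ j ∈ sᶜ, f j y / f i y) := by rw [← Finset.sum_div]; gcongr
      _ ≤ 2 * ∑ j ∈ sᶜ, √(f j y / f i y) := by
          gcongr
          exact sqrt_sum_le_sum_sqrt _ fun j _ => (div_pos (hpos j y) hfi).le
      _ = 2 * ∑ j ∈ sᶜ, (f j y / f i y) ^ (1 / 2 : ℝ) := by simp only [Real.sqrt_eq_rpow]
  calc f i y * Real.log ((∑ j, f j y) / f i y)
      ≤ f i y * (Real.log s.card + (near / (s.card * f i y) - 1) +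
          2 * ∑ j ∈ sᶜ, (f j y / f i y) ^ (1 / 2 : ℝ)) := by
        rw [← Finset.sum_add_sum_compl s, hsplit]
        gcongr
    _ = _ := by
        rw [← Finset.mul_sum]
        field_simp

lemma le_mul_log_sum_div (hpos : ∀ j y, 0 < f j y) (i : ι) {s : Finset ι} (hs : s.Nonempty)
    (y : Y) :
    f i y * Real.log s.card +
        (s.card : ℝ)⁻¹ * ∑ j ∈ s, 2 * (f i y - f i y * (f j y / f i y) ^ (-(1 / 2) : ℝ)) ≤
      f i y * Real.log ((∑ j, f j y) / f i y) := by
  have hfi : 0 < f i y := hpos i y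
  have hm : (0 : ℝ) < s.card := by exact_mod_cast hs.card_pos
  have hratio : ∀ j, 0 < f j y / f i y := fun j => div_pos (hpos j y) hfi
  have hsum : 0 < ∑ j ∈ s, f j y / f i y := Finset.sum_pos (fun j _ => hratio j) hs
  have hjensen : (s.card : ℝ)⁻¹ * ∑ j ∈ s, Real.log (f j y / f i y) ≤
      Real.log ((s.card : ℝ)⁻¹ * ∑ j ∈ s, f j y / f i y) := by
    have h := strictConcaveOn_log_Ioi.concaveOn.le_map_sum (t := s)
      (w := fun _ => (s.card : ℝ)⁻¹) (p := fun j => f j y / f i y)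
      (fun _ _ => by positivity) (by simp [hm.ne']) (fun j _ => hratio j)
    simpa only [smul_eq_mul, ← Finset.mul_sum] using h
  rw [Real.log_mul (by positivity) hsum.ne', Real.log_inv] at hjensen
  have hsub : Real.log (∑ j ∈ s, f j y / f i y) ≤ Real.log ((∑ j, f j y) / f i y) := by
    refine Real.log_le_log hsum ?_
    rw [← Finset.sum_div]
    exact div_le_div_of_nonneg_right
      (Finset.sum_le_univ_sum_of_nonneg fun j => (hpos j y).le) hfi.le
  calc _ = f i y * (Real.log s.card +
          (s.card : ℝ)⁻¹ * ∑ j ∈ s, (2 - 2 * (f j y / f i y) ^ (-(1 / 2) : ℝ))) := by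
        simp only [mul_add, Finset.mul_sum]
        congr 1
        exact Finset.sum_congr rfl fun j _ => by ring
    _ ≤ f i y * (Real.log s.card + (s.card : ℝ)⁻¹ * ∑ j ∈ s, Real.log (f j y / f i y)) := by
        gcongr with j _
        exact two_sub_two_mul_rpow_le_log (hratio j)
    _ ≤ f i y * Real.log ((∑ j, f j y) / f i y) := by
        gcongr
        linarith

variable [MeasurableSpace Y] {μ : Measure Y}

lemma integrable_mul_log_sum_div (hpos : ∀ j y, 0 < f j y) (hint : ∀ j, Integrable (f j) μ)
    (i : ι) : Integrable (fun y => f i y * Real.log ((∑ j, f j y) / f i y)) μ := by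
  have hsum : Integrable (fun y => ∑ j, f j y) μ := integrable_finsetSum _ fun j _ => hint j
  refine (hsum.sub (hint i)).mono' ?_ (ae_of_all _ fun y => ?_)
  · exact ((hint i).aemeasurable.mul
      (hsum.aemeasurable.div (hint i).aemeasurable).log).aestronglyMeasurable
  · rw [Real.norm_of_nonneg (mul_log_sum_div_nonneg hpos i y)]
    exact mul_log_sum_div_le_sum_sub hpos i y

lemma integral_mul_logb_div_mul_sum (hpos : ∀ j y, 0 < f j y) (hone : ∀ j, ∫ y, f j y ∂μ = 1)
    (i : ι) {c : ℝ} (hc : 0 < c) :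
    ∫ y, f i y * Real.logb 2 (f i y / (c⁻¹ * ∑ j, f j y)) ∂μ =
      (Real.log c - equivocation μ f i) / Real.log 2 := by
  have hint : ∀ j, Integrable (f j) μ := fun j => integrable_of_integral_eq_one (hone j)
  have hpoint : ∀ y, f i y * Real.logb 2 (f i y / (c⁻¹ * ∑ j, f j y)) =
      (f i y * Real.log c - f i y * Real.log ((∑ j, f j y) / f i y)) / Real.log 2 := by
    intro y
    have hi := hpos i y
    have hsum : 0 < ∑ j, f j y := hi.trans_le (self_le_sum_of_pos hpos i y)
    rw [Real.logb, Real.log_div hi.ne' (by positivity), Real.log_mul (by positivity) hsum.ne',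
      Real.log_inv, Real.log_div hsum.ne' hi.ne']
    ring
  simp_rw [hpoint]
  rw [integral_div, integral_sub ((hint i).mul_const _) (integrable_mul_log_sum_div hpos hint i),
    integral_mul_const, hone, one_mul, equivocation]

lemma equivocation_le_log_card_add [DecidableEq ι] (hpos : ∀ j y, 0 < f j y)
    (hone : ∀ j, ∫ y, f j y ∂μ = 1) {i : ι} {s : Finset ι} (hi : i ∈ s) :
    equivocation μ f i ≤
      Real.log s.card + 2 * ∑ j ∈ sᶜ, chernoffCoeff μ (1 / 2) (f i) (f j) := by
  have hint : ∀ j, Integrable (f j) μ := fun j => integrable_of_integral_eq_one (hone j)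
  have hs : (s.card : ℝ) ≠ 0 := by exact_mod_cast Finset.card_ne_zero_of_mem hi
  have hlog : Integrable (fun y => f i y * Real.log s.card) μ := (hint i).mul_const _
  have hmean : Integrable (fun y => (∑ j ∈ s, f j y) / s.card) μ :=
    (integrable_finsetSum _ fun j _ => hint j).div_const _
  have hexcess : Integrable (fun y => (∑ j ∈ s, f j y) / s.card - f i y) μ := hmean.sub (hint i)
  have haff : ∀ j, Integrable (fun y => f i y * (f j y / f i y) ^ (1 / 2 : ℝ)) μ := fun j =>
    integrable_mul_div_rpow_half (hpos i) (hpos j) (hint i) (hint j)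
  have hfar : Integrable (fun y => 2 * ∑ j ∈ sᶜ, f i y * (f j y / f i y) ^ (1 / 2 : ℝ)) μ :=
    (integrable_finsetSum _ fun j _ => haff j).const_mul _
  refine (integral_mono (integrable_mul_log_sum_div hpos hint i)
    ((hlog.add hexcess).add hfar) (mul_log_sum_div_le hpos hi)).trans_eq ?_
  rw [integral_add' (hlog.add hexcess) hfar, integral_add' hlog hexcess,
    integral_sub hmean (hint i), integral_mul_const, integral_div,
    integral_finsetSum _ fun j _ => hint j, integral_const_mul,
    integral_finsetSum _ fun j _ => haff j]
  simp [hone, hs, chernoffCoeff]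

lemma log_card_sub_le_equivocation (hpos : ∀ j y, 0 < f j y) (hone : ∀ j, ∫ y, f j y ∂μ = 1)
    (i : ι) {s : Finset ι} (hs : s.Nonempty) {c : ℝ}
    (hint : ∀ j ∈ s, Integrable (fun y => f i y * (f j y / f i y) ^ (-(1 / 2) : ℝ)) μ)
    (hc : ∀ j ∈ s, chernoffCoeff μ (-(1 / 2)) (f i) (f j) ≤ c) :
    Real.log s.card - 2 * (c - 1) ≤ equivocation μ f i := by
  have hf : ∀ j, Integrable (f j) μ := fun j => integrable_of_integral_eq_one (hone j)
  have hm : (0 : ℝ) < s.card := by exact_mod_cast hs.card_pos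
  have hdiff : ∀ j ∈ s, Integrable
      (fun y => 2 * (f i y - f i y * (f j y / f i y) ^ (-(1 / 2) : ℝ))) μ :=
    fun j hj => ((hf i).sub (hint j hj)).const_mul 2
  have hmean : ∑ j ∈ s, 2 * (1 - c) ≤
      ∑ j ∈ s, 2 * (1 - chernoffCoeff μ (-(1 / 2)) (f i) (f j)) :=
    Finset.sum_le_sum fun j hj => by linarith [hc j hj]
  calc Real.log s.card - 2 * (c - 1)
      = Real.log s.card + (s.card : ℝ)⁻¹ * ∑ j ∈ s, 2 * (1 - c) := by
        rw [Finset.sum_const, nsmul_eq_mul, inv_mul_cancel_left₀ hm.ne']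
        ring
    _ ≤ Real.log s.card +
          (s.card : ℝ)⁻¹ * ∑ j ∈ s, 2 * (1 - chernoffCoeff μ (-(1 / 2)) (f i) (f j)) := by gcongr
    _ = ∫ y, f i y * Real.log s.card +
          (s.card : ℝ)⁻¹ * ∑ j ∈ s, 2 * (f i y - f i y * (f j y / f i y) ^ (-(1 / 2) : ℝ)) ∂μ := by
        rw [integral_add ((hf i).mul_const _) ((integrable_finsetSum _ hdiff).const_mul _),
          integral_mul_const, hone, one_mul, integral_const_mul, integral_finsetSum _ hdiff]
        congr 2
        refine Finset.sum_congr rfl fun j hj => ?_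
        rw [integral_const_mul, integral_sub (hf i) (hint j hj), hone, chernoffCoeff]
    _ ≤ equivocation μ f i :=
        integral_mono (((hf i).mul_const _).add ((integrable_finsetSum _ hdiff).const_mul _))
          (integrable_mul_log_sum_div hpos hf i) (le_mul_log_sum_div hpos i hs)

end Mixture

/-! ## Gaussian densities -/

/-- The squared Euclidean norm on `ℂ^ι`. The norm of the type `ι → ℂ` itself is the supremum
norm. -/
def sqNorm {ι : Type*} [Fintype ι] (v : ι → ℂ) : ℝ := ∑ r, ‖v r‖ ^ 2

/-- The density of the law `𝒩_ℂ(a, 1)` on `ℂ^ι`. -/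
def gaussDens {ι : Type*} [Fintype ι] (a y : ι → ℂ) : ℝ :=
  (Real.pi ^ Fintype.card ι)⁻¹ * Real.exp (-sqNorm (y - a))

section Gaussian

variable {ι : Type*} [Fintype ι]

lemma gaussDens_pos (a y : ι → ℂ) : 0 < gaussDens a y := by
  unfold gaussDens
  positivity

lemma integral_gaussDens (a : ι → ℂ) : ∫ y, gaussDens a y = 1 := by
  have hprod : ∀ y, gaussDens a y = ∏ r, (Real.pi⁻¹ * Real.exp (-‖y r - a r‖ ^ 2)) := by
    intro y
    rw [Finset.prod_mul_distrib, ← Real.exp_sum]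
    simp [gaussDens, sqNorm]
  have hone : ∀ z : ℂ, ∫ y : ℂ, Real.pi⁻¹ * Real.exp (-‖y - z‖ ^ 2) = 1 := by
    intro z
    have h := GaussianFourier.integral_rexp_neg_mul_sq_norm (V := ℂ) (b := 1) one_pos
    simp only [neg_mul, one_mul, Complex.finrank_real_complex] at h
    rw [integral_const_mul, integral_sub_right_eq_self (fun y : ℂ => Real.exp (-‖y‖ ^ 2)) z, h]
    norm_num
  simp_rw [hprod]
  rw [integral_fintype_prod_volume_eq_prod
    (fun r (z : ℂ) => Real.pi⁻¹ * Real.exp (-‖z - a r‖ ^ 2))]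
  simp only [hone, Finset.prod_const_one]

lemma integrable_gaussDens (a : ι → ℂ) : Integrable (gaussDens a) :=
  integrable_of_integral_eq_one (integral_gaussDens a)

lemma gaussDens_mul_div_rpow (t : ℝ) (a b y : ι → ℂ) :
    gaussDens a y * (gaussDens b y / gaussDens a y) ^ t =
      Real.exp (-(t * (1 - t)) * sqNorm (a - b)) * gaussDens (a + (t : ℂ) • (b - a)) y := by
  have hratio : gaussDens b y / gaussDens a y =
      Real.exp (sqNorm (y - a) - sqNorm (y - b)) := by
    unfold gaussDens
    rw [mul_div_mul_left _ _ (by positivity), ← Real.exp_sub]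
    ring_nf
  have hquad : -sqNorm (y - a) + (sqNorm (y - a) - sqNorm (y - b)) * t =
      -(t * (1 - t)) * sqNorm (a - b) + -sqNorm (y - (a + (t : ℂ) • (b - a))) := by
    simp only [sqNorm, ← Finset.sum_neg_distrib, ← Finset.sum_sub_distrib,
      ← Finset.sum_add_distrib, Finset.mul_sum, Finset.sum_mul]
    refine Finset.sum_congr rfl fun r _ => ?_
    simp only [Complex.sq_norm, Complex.normSq_apply, Pi.sub_apply, Pi.add_apply, Pi.smul_apply,
      smul_eq_mul, Complex.sub_re, Complex.sub_im, Complex.add_re, Complex.add_im,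
      Complex.mul_re, Complex.mul_im, Complex.ofReal_re, Complex.ofReal_im]
    ring
  rw [hratio, ← Real.exp_mul]
  unfold gaussDens
  rw [mul_assoc, ← Real.exp_add, mul_left_comm, ← Real.exp_add, hquad]

lemma integrable_gaussDens_mul_div_rpow (t : ℝ) (a b : ι → ℂ) :
    Integrable fun y => gaussDens a y * (gaussDens b y / gaussDens a y) ^ t := by
  simp_rw [gaussDens_mul_div_rpow]
  exact (integrable_gaussDens _).const_mul _

lemma chernoffCoeff_gaussDens (t : ℝ) (a b : ι → ℂ) :
    chernoffCoeff volume t (gaussDens a) (gaussDens b) =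
      Real.exp (-(t * (1 - t)) * sqNorm (a - b)) := by
  simp_rw [chernoffCoeff, gaussDens_mul_div_rpow, integral_const_mul, integral_gaussDens, mul_one]

end Gaussian

/-! ## Mutual information and lost dimensions -/

section Coset

variable {F ι : Type*} [Field F] [Finite ι]

lemma exists_finset_coord_card_le_finrank (W : Submodule F (ι → F)) :
    ∃ T : Finset ι, T.card ≤ Module.finrank F W ∧ ∀ w ∈ W, (∀ t ∈ T, w t = 0) → w = 0 := by
  classical
  let coord : ι → Module.Dual F W := fun t => (LinearMap.proj t).comp W.subtype
  obtain ⟨κ, b, hb, hspan, hli⟩ := exists_linearIndependent' F coord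
  have : Finite κ := Finite.of_injective b hb
  have : Fintype κ := Fintype.ofFinite κ
  refine ⟨Finset.univ.image b, ?_, fun w hw hwT => funext fun t => ?_⟩
  · rw [Finset.card_image_of_injective _ hb, Finset.card_univ, ← Subspace.dual_finrank_eq]
    exact hli.fintype_card_le_finrank
  · have hker : Submodule.span F (Set.range (coord ∘ b)) ≤
        LinearMap.ker (LinearMap.applyₗ (R := F) (M₂ := F) (⟨w, hw⟩ : W)) := by
      rw [Submodule.span_le]
      rintro _ ⟨k, rfl⟩
      exact hwT (b k) (Finset.mem_image_of_mem b (Finset.mem_univ k))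
    rw [hspan] at hker
    exact hker (Submodule.subset_span ⟨t, rfl⟩)

lemma card_le_pow_finrank_of_sub_mem {𝒳 : Finset F} (h𝒳 : 𝒳.Nonempty) (W : Submodule F (ι → F))
    {s : Finset (ι → 𝒳)}
    (hs : ∀ x ∈ s, ∀ x' ∈ s, (fun t => (x t : F)) - (fun t => (x' t : F)) ∈ W) :
    s.card ≤ 𝒳.card ^ Module.finrank F W := by
  classical
  obtain ⟨T, hTcard, hT⟩ := exists_finset_coord_card_le_finrank W
  have hinj : Set.InjOn (fun (x : ι → 𝒳) (t : T) => x t) s := fun x hx x' hx' hxx => by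
    have hzero := hT _ (hs x hx x' hx') fun t ht =>
      sub_eq_zero.2 (congrArg Subtype.val (congrFun hxx ⟨t, ht⟩))
    exact funext fun t => Subtype.ext (sub_eq_zero.1 (congrFun hzero t))
  calc s.card ≤ (Finset.univ : Finset (T → 𝒳)).card :=
        Finset.card_le_card_of_injOn _ (fun _ _ => Finset.mem_univ _) hinj
    _ = 𝒳.card ^ T.card := by simp
    _ ≤ 𝒳.card ^ Module.finrank F W := Nat.pow_le_pow_right h𝒳.card_pos hTcard

end Coset

section MutualInfo

/-- The noiseless channel output for a codeword. -/
def codePoint (𝒳 : Finset ℂ) {Nr Nt : ℕ} (G : Matrix (Fin Nr) (Fin Nt) ℂ) (x : Fin Nt → 𝒳) :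
    Fin Nr → ℂ :=
  G.mulVec fun t => (x t : ℂ)

/-- The difference of two codewords. -/
def codeDiff {𝒳 : Finset ℂ} {Nt : ℕ} (x x' : Fin Nt → 𝒳) : Fin Nt → ℂ :=
  (fun t => (x t : ℂ)) - fun t => (x' t : ℂ)

/-- The dimension of the span of the codeword differences whose image under the channel `G` has
squared norm below `A`. Up to a small error, the codewords carry `M` bits for each of the `Nt`
dimensions but these. -/
def lostDim (𝒳 : Finset ℂ) {Nr Nt : ℕ} (A : ℝ) (G : Matrix (Fin Nr) (Fin Nt) ℂ) : ℕ :=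
  Module.finrank ℂ (Submodule.span ℂ
    {d | (∃ x x' : Fin Nt → 𝒳, d = codeDiff x x') ∧ sqNorm (G.mulVec d) < A})

variable {𝒳 : Finset ℂ} {M : ℝ} {Nr Nt : ℕ} (G : Matrix (Fin Nr) (Fin Nt) ℂ)

lemma card_pos_of_eq_two_rpow (hM : (𝒳.card : ℝ) = (2 : ℝ) ^ M) : 0 < 𝒳.card := by
  have h : (0 : ℝ) < 𝒳.card := by
    rw [hM]
    positivity
  exact_mod_cast h

lemma card_codewords : (Fintype.card (Fin Nt → 𝒳) : ℝ) = (𝒳.card : ℝ) ^ Nt := by simp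

lemma lostDim_le (A : ℝ) : lostDim 𝒳 A G ≤ Nt := by
  simpa [lostDim] using Submodule.finrank_le (R := ℂ) (M := Fin Nt → ℂ) _

lemma codePoint_sub_codePoint (x x' : Fin Nt → 𝒳) :
    codePoint 𝒳 G x - codePoint 𝒳 G x' = G.mulVec (codeDiff x x') :=
  (Matrix.mulVec_sub _ _ _).symm

lemma outputDensity_eq_gaussDens (x : Fin Nt → 𝒳) (y : Fin Nr → ℂ) :
    outputDensity G (fun t => (x t : ℂ)) y = gaussDens (codePoint 𝒳 G x) y := by
  simp [outputDensity, gaussDens, sqNorm, codePoint]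

lemma mutualInfo_eq (h𝒳 : 0 < 𝒳.card) : mutualInfo 𝒳 G =
    (Nt * Real.log 𝒳.card - ((𝒳.card : ℝ) ^ Nt)⁻¹ *
      ∑ x, equivocation volume (fun x => gaussDens (codePoint 𝒳 G x)) x) / Real.log 2 := by
  have hc : (0 : ℝ) < (𝒳.card : ℝ) ^ Nt := by positivity
  simp only [mutualInfo, outputMarginal, outputDensity_eq_gaussDens]
  rw [Finset.sum_congr rfl fun x _ => integral_mul_logb_div_mul_sum (fun _ _ => gaussDens_pos _ _)
      (fun x => integral_gaussDens (codePoint 𝒳 G x)) x hc,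
    ← Finset.sum_div, Finset.sum_sub_distrib, Finset.sum_const, nsmul_eq_mul, Finset.card_univ,
    card_codewords, Real.log_pow]
  field_simp

lemma log_card_of_eq_two_rpow (hM : (𝒳.card : ℝ) = (2 : ℝ) ^ M) :
    Real.log 𝒳.card = M * Real.log 2 := by
  rw [hM, Real.log_rpow two_pos]

lemma le_mutualInfo_of_equivocation_le (hM : (𝒳.card : ℝ) = (2 : ℝ) ^ M) {c : ℝ}
    (h : ∀ x, equivocation volume (fun x => gaussDens (codePoint 𝒳 G x)) x ≤ c * Real.log 2) :
    Nt * M - c ≤ mutualInfo 𝒳 G := by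
  have h𝒳 := card_pos_of_eq_two_rpow hM
  have hc : (0 : ℝ) < (𝒳.card : ℝ) ^ Nt := by positivity
  have hsum := Finset.sum_le_card_nsmul Finset.univ _ _ fun x _ => h x
  rw [nsmul_eq_mul, Finset.card_univ, card_codewords, ← inv_mul_le_iff₀ hc] at hsum
  rw [mutualInfo_eq G h𝒳, log_card_of_eq_two_rpow hM, le_div_iff₀ (Real.log_pos one_lt_two)]
  linarith

lemma mutualInfo_le_of_le_equivocation (hM : (𝒳.card : ℝ) = (2 : ℝ) ^ M) {c : ℝ}
    (h : ∀ x, c * Real.log 2 ≤ equivocation volume (fun x => gaussDens (codePoint 𝒳 G x)) x) :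
    mutualInfo 𝒳 G ≤ Nt * M - c := by
  have h𝒳 := card_pos_of_eq_two_rpow hM
  have hc : (0 : ℝ) < (𝒳.card : ℝ) ^ Nt := by positivity
  have hsum := Finset.card_nsmul_le_sum Finset.univ _ _ fun x _ => h x
  rw [nsmul_eq_mul, Finset.card_univ, card_codewords, ← le_inv_mul_iff₀ hc] at hsum
  rw [mutualInfo_eq G h𝒳, log_card_of_eq_two_rpow hM, div_le_iff₀ (Real.log_pos one_lt_two)]
  linarith

lemma mutualInfo_nonneg (h𝒳 : 0 < 𝒳.card) : 0 ≤ mutualInfo 𝒳 G := by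
  classical
  have hM : (𝒳.card : ℝ) = (2 : ℝ) ^ Real.logb 2 𝒳.card :=
    (Real.rpow_logb two_pos (by norm_num) (by positivity)).symm
  refine (sub_self _).symm.trans_le (le_mutualInfo_of_equivocation_le G hM fun x => ?_)
  refine (equivocation_le_log_card_add (s := Finset.univ) (fun _ _ => gaussDens_pos _ _)
    (fun _ => integral_gaussDens _) (Finset.mem_univ x)).trans_eq ?_
  rw [Finset.card_univ, card_codewords, Real.log_pow, log_card_of_eq_two_rpow hM]
  simp [mul_assoc]

lemma exists_const_mul_exp_le (k : ℝ) {ε : ℝ} (hε : 0 < ε) :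
    ∃ A : ℝ, 0 < A ∧ k * Real.exp (-(1 / 4) * A) ≤ ε := by
  have h : Tendsto (fun A : ℝ => k * Real.exp (-(1 / 4) * A)) atTop (𝓝 (k * 0)) :=
    (Real.tendsto_exp_atBot.comp
      (tendsto_id.const_mul_atTop_of_neg (by norm_num))).const_mul k
  rw [mul_zero] at h
  obtain ⟨A, hA, hA0⟩ := ((h.eventually_lt_const hε).and (eventually_gt_atTop 0)).exists
  exact ⟨A, hA0, hA.le⟩

/- A codeword is confused only with those that differ from it by a vector of the lost subspace, and
there are at most `2 ^ (M r)` of these when that subspace has dimension `r`. -/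
lemma exists_sub_lostDim_mul_sub_le_mutualInfo (Nr Nt : ℕ) (hM : (𝒳.card : ℝ) = (2 : ℝ) ^ M)
    {ε : ℝ} (hε : 0 < ε) : ∃ A : ℝ, 0 < A ∧ ∀ G : Matrix (Fin Nr) (Fin Nt) ℂ,
      ((Nt : ℝ) - lostDim 𝒳 A G) * M - ε ≤ mutualInfo 𝒳 G := by
  classical
  have h𝒳 := card_pos_of_eq_two_rpow hM
  obtain ⟨A, hA0, hA⟩ := exists_const_mul_exp_le (2 * (𝒳.card : ℝ) ^ Nt)
    (mul_pos hε (Real.log_pos one_lt_two))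
  refine ⟨A, hA0, fun G => ?_⟩
  set W : Submodule ℂ (Fin Nt → ℂ) := Submodule.span ℂ
    {d | (∃ x x' : Fin Nt → 𝒳, d = codeDiff x x') ∧ sqNorm (G.mulVec d) < A}
  have hequiv : ∀ x, equivocation volume (fun x => gaussDens (codePoint 𝒳 G x)) x ≤
      (lostDim 𝒳 A G * M + ε) * Real.log 2 := by
    intro x
    set s : Finset (Fin Nt → 𝒳) := {x' | codeDiff x x' ∈ W}
    have hxs : x ∈ s := Finset.mem_filter.2 ⟨Finset.mem_univ x, by
      rw [codeDiff, sub_self]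
      exact W.zero_mem⟩
    have hcard : s.card ≤ 𝒳.card ^ lostDim 𝒳 A G :=
      card_le_pow_finrank_of_sub_mem (Finset.card_pos.1 h𝒳) W fun x' hx' x'' hx'' => by
        simpa [codeDiff] using W.sub_mem (Finset.mem_filter.1 hx'').2 (Finset.mem_filter.1 hx').2
    have hlog : Real.log s.card ≤ lostDim 𝒳 A G * (M * Real.log 2) := by
      rw [← log_card_of_eq_two_rpow hM, ← Real.log_pow]
      exact Real.log_le_log (by exact_mod_cast Finset.card_pos.2 ⟨x, hxs⟩) (by exact_mod_cast hcard)
    have hfar : ∀ x' ∈ sᶜ, chernoffCoeff volume (1 / 2) (gaussDens (codePoint 𝒳 G x))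
        (gaussDens (codePoint 𝒳 G x')) ≤ Real.exp (-(1 / 4) * A) := by
      intro x' hx'
      have hA : A ≤ sqNorm (G.mulVec (codeDiff x x')) := by
        by_contra! hlt
        exact Finset.mem_compl.1 hx' (Finset.mem_filter.2
          ⟨Finset.mem_univ _, Submodule.subset_span ⟨⟨x, x', rfl⟩, hlt⟩⟩)
      rw [chernoffCoeff_gaussDens, codePoint_sub_codePoint]
      exact Real.exp_le_exp.2 (by linarith)
    have hsum : ∑ x' ∈ sᶜ, chernoffCoeff volume (1 / 2) (gaussDens (codePoint 𝒳 G x))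
        (gaussDens (codePoint 𝒳 G x')) ≤ (𝒳.card : ℝ) ^ Nt * Real.exp (-(1 / 4) * A) := by
      refine (Finset.sum_le_card_nsmul _ _ _ hfar).trans ?_
      rw [nsmul_eq_mul, ← card_codewords]
      gcongr
      exact Finset.card_le_univ _
    have h := equivocation_le_log_card_add (fun _ _ => gaussDens_pos _ _)
      (fun x' => integral_gaussDens (codePoint 𝒳 G x')) hxs
    linarith
  linarith [le_mutualInfo_of_equivocation_le G hM hequiv]

lemma exists_sqNorm_codeDiff_le (𝒳 : Finset ℂ) (Nr Nt : ℕ) :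
    ∃ b : ℝ, ∀ (G : Matrix (Fin Nr) (Fin Nt) ℂ) (x x' : Fin Nt → 𝒳) (ρ : ℝ),
      (∀ r t, x t ≠ x' t → ‖G r t‖ ≤ ρ) → sqNorm (G.mulVec (codeDiff x x')) ≤ b * ρ ^ 2 := by
  set β : ℝ := ∑ z ∈ 𝒳, ‖z‖
  have hβ : ∀ z : 𝒳, ‖(z : ℂ)‖ ≤ β := fun z =>
    Finset.single_le_sum (f := fun z : ℂ => ‖z‖) (fun _ _ => norm_nonneg _) z.2
  refine ⟨Nr * (Nt * (β + β)) ^ 2, fun G x x' ρ hG => ?_⟩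
  have hentry : ∀ r t, ‖G r t * codeDiff x x' t‖ ≤ |ρ| * (β + β) := by
    intro r t
    by_cases ht : x t = x' t
    · simp only [codeDiff, Pi.sub_apply, ht, sub_self, mul_zero, norm_zero]
      have := (norm_nonneg _).trans (hβ (x t))
      positivity
    · rw [norm_mul]
      exact mul_le_mul ((hG r t ht).trans (le_abs_self ρ))
        ((norm_sub_le _ _).trans (add_le_add (hβ _) (hβ _))) (norm_nonneg _) (abs_nonneg ρ)
  have hrow : ∀ r, ‖G.mulVec (codeDiff x x') r‖ ≤ Nt * (|ρ| * (β + β)) := fun r =>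
    (norm_sum_le_of_le _ fun t _ => hentry r t).trans_eq (by simp)
  calc sqNorm (G.mulVec (codeDiff x x')) ≤ ∑ _ : Fin Nr, (Nt * (|ρ| * (β + β))) ^ 2 :=
        Finset.sum_le_sum fun r _ => pow_le_pow_left₀ (norm_nonneg _) (hrow r) 2
    _ = Nr * (Nt * (β + β)) ^ 2 * ρ ^ 2 := by
        simp only [Finset.sum_const, Finset.card_univ, Fintype.card_fin, nsmul_eq_mul, mul_pow,
          sq_abs]
        ring

lemma exists_pos_exp_mul_sq_sub_one_lt (b : ℝ) {ε : ℝ} (hε : 0 < ε) :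
    ∃ ρ : ℝ, 0 < ρ ∧ 2 * (Real.exp (b * ρ ^ 2) - 1) < ε := by
  have hcont : Continuous fun ρ : ℝ => 2 * (Real.exp (b * ρ ^ 2) - 1) := by fun_prop
  have h := (hcont.tendsto 0).mono_left (nhdsWithin_le_nhds (s := Set.Ioi 0))
  norm_num at h
  obtain ⟨ρ, hρ, hρ0⟩ := ((h.eventually_lt_const hε).and self_mem_nhdsWithin).exists
  exact ⟨ρ, hρ0, hρ⟩

/-- The codewords that agree with `x` outside the set `T` of transmit antennas. -/
def sameOff (T : Finset (Fin Nt)) (x : Fin Nt → 𝒳) : Finset (Fin Nt → 𝒳) :=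
  Fintype.piFinset fun t => if t ∈ T then Finset.univ else {x t}

lemma card_sameOff (T : Finset (Fin Nt)) (x : Fin Nt → 𝒳) :
    (sameOff T x).card = 𝒳.card ^ T.card := by
  have h : ∀ t, (if t ∈ T then (Finset.univ : Finset 𝒳) else {x t}).card =
      if t ∈ T then 𝒳.card else 1 := fun t => by split_ifs <;> simp
  simp only [sameOff, Fintype.card_piFinset, h]
  simp

lemma self_mem_sameOff (T : Finset (Fin Nt)) (x : Fin Nt → 𝒳) : x ∈ sameOff T x :=
  Fintype.mem_piFinset.2 fun t => by split_ifs <;> simp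

lemma mem_of_mem_sameOff {T : Finset (Fin Nt)} {x x' : Fin Nt → 𝒳} (hx' : x' ∈ sameOff T x)
    {t : Fin Nt} (ht : x t ≠ x' t) : t ∈ T := by
  by_contra htT
  have h := Fintype.mem_piFinset.1 hx' t
  rw [if_neg htT, Finset.mem_singleton] at h
  exact ht h.symm

lemma exists_mutualInfo_le_sub_card_mul_add (Nr Nt : ℕ) (hM : (𝒳.card : ℝ) = (2 : ℝ) ^ M) {η : ℝ}
    (hη : 0 < η) : ∃ ρ : ℝ, 0 < ρ ∧ ∀ (G : Matrix (Fin Nr) (Fin Nt) ℂ) (T : Finset (Fin Nt)),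
      (∀ r, ∀ t ∈ T, ‖G r t‖ ≤ ρ) → mutualInfo 𝒳 G ≤ ((Nt : ℝ) - T.card) * M + η := by
  obtain ⟨b, hb⟩ := exists_sqNorm_codeDiff_le 𝒳 Nr Nt
  obtain ⟨ρ, hρ0, hρ⟩ := exists_pos_exp_mul_sq_sub_one_lt (3 / 4 * b)
    (mul_pos hη (Real.log_pos one_lt_two))
  refine ⟨ρ, hρ0, fun G T hT => ?_⟩
  have hequiv : ∀ x, (T.card * M - η) * Real.log 2 ≤
      equivocation volume (fun x => gaussDens (codePoint 𝒳 G x)) x := by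
    intro x
    have hnear : ∀ x' ∈ sameOff T x, chernoffCoeff volume (-(1 / 2)) (gaussDens (codePoint 𝒳 G x))
        (gaussDens (codePoint 𝒳 G x')) ≤ Real.exp (3 / 4 * b * ρ ^ 2) := by
      intro x' hx'
      have := hb G x x' ρ fun r t ht => hT r t (mem_of_mem_sameOff hx' ht)
      rw [chernoffCoeff_gaussDens, codePoint_sub_codePoint]
      exact Real.exp_le_exp.2 (by linarith)
    have h := log_card_sub_le_equivocation (fun _ _ => gaussDens_pos _ _)
      (fun x => integral_gaussDens (codePoint 𝒳 G x)) x ⟨x, self_mem_sameOff T x⟩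
      (fun x' _ => integrable_gaussDens_mul_div_rpow _ _ _) hnear
    rw [card_sameOff, Nat.cast_pow, Real.log_pow, log_card_of_eq_two_rpow hM] at h
    linarith
  linarith [mutualInfo_le_of_le_equivocation G hM hequiv]

lemma measurable_mutualInfo {α : Type*} [MeasurableSpace α]
    {H : α → Matrix (Fin Nr) (Fin Nt) ℂ} (hH : ∀ r t, Measurable fun a => H a r t) :
    Measurable fun a => mutualInfo 𝒳 (H a) := by
  have hdens : ∀ x : Fin Nt → ℂ, Measurable fun p : α × (Fin Nr → ℂ) =>
      outputDensity (H p.1) x p.2 := by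
    intro x
    unfold outputDensity
    simp only [Matrix.mulVec, dotProduct]
    fun_prop
  have hmarg : Measurable fun p : α × (Fin Nr → ℂ) => outputMarginal 𝒳 (H p.1) p.2 := by
    unfold outputMarginal
    fun_prop
  refine (Finset.measurable_sum _ fun x _ => StronglyMeasurable.measurable ?_).const_mul _
  have hx := hdens fun t => (x t : ℂ)
  refine StronglyMeasurable.integral_prod_right' (f := fun p : α × (Fin Nr → ℂ) =>
    outputDensity (H p.1) (fun t => (x t : ℂ)) p.2 * Real.logb 2
      (outputDensity (H p.1) (fun t => (x t : ℂ)) p.2 / outputMarginal 𝒳 (H p.1) p.2))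
    (Measurable.stronglyMeasurable ?_)
  unfold Real.logb
  fun_prop

end MutualInfo

/-! ## Small-ball probabilities -/

section SmallBall

lemma gaussianPDFReal_le_of_abs_sub_le (μ : ℝ) (v : NNReal) {x y : ℝ} (h : |x - μ| ≤ |y - μ|) :
    gaussianPDFReal μ v y ≤ gaussianPDFReal μ v x := by
  have hsq : (x - μ) ^ 2 ≤ (y - μ) ^ 2 := sq_le_sq.2 h
  unfold gaussianPDFReal
  gcongr

lemma gaussianReal_real_eq_integral (μ : ℝ) {v : NNReal} (hv : v ≠ 0) (s : Set ℝ) :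
    (gaussianReal μ v).real s = ∫ x in s, gaussianPDFReal μ v x := by
  rw [measureReal_def, gaussianReal_apply_eq_integral μ hv,
    ENNReal.toReal_ofReal (integral_nonneg fun _ => gaussianPDFReal_nonneg _ _ _)]

lemma gaussianReal_real_Icc_le (μ : ℝ) {v : NNReal} (hv : v ≠ 0) {a b : ℝ} (hab : a ≤ b) :
    (gaussianReal μ v).real (Set.Icc a b) ≤ (b - a) * gaussianPDFReal μ v μ := by
  rw [gaussianReal_real_eq_integral μ hv, ← Real.volume_real_Icc_of_le hab, ← smul_eq_mul,
    ← setIntegral_const]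
  refine setIntegral_mono (integrable_gaussianPDFReal μ v).integrableOn
    (integrable_const _) fun x => gaussianPDFReal_le_of_abs_sub_le μ v ?_
  simp

lemma le_gaussianReal_real_Icc_neg {v : NNReal} (hv : v ≠ 0) {s t : ℝ} (hs : 0 ≤ s) (hst : s ≤ t) :
    2 * s * gaussianPDFReal 0 v t ≤ (gaussianReal 0 v).real (Set.Icc (-s) s) := by
  rw [gaussianReal_real_eq_integral 0 hv, show 2 * s = s - -s by ring,
    ← Real.volume_real_Icc_of_le (by linarith), ← smul_eq_mul, ← setIntegral_const]
  refine setIntegral_mono_on (integrable_const _) (integrable_gaussianPDFReal 0 v).integrableOn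
    measurableSet_Icc fun x hx => gaussianPDFReal_le_of_abs_sub_le 0 v ?_
  rw [sub_zero, sub_zero, abs_of_nonneg (hs.trans hst)]
  exact (abs_le.2 hx).trans hst

lemma stdComplexGaussian_real_apply {s : Set ℂ} (hs : MeasurableSet s) :
    stdComplexGaussian.real s = ((gaussianReal 0 (1 / 2)).prod (gaussianReal 0 (1 / 2))).real
      (Complex.measurableEquivRealProd.symm ⁻¹' s) :=
  map_measureReal_apply Complex.measurableEquivRealProd.symm.measurable hs

lemma exists_stdComplexGaussian_closedBall_le : ∃ C : ℝ, 0 ≤ C ∧ ∀ (z : ℂ) (s : ℝ), 0 ≤ s →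
    stdComplexGaussian.real (Metric.closedBall z s) ≤ C * s ^ 2 := by
  set c : ℝ := gaussianPDFReal 0 (1 / 2) 0
  have hc : 0 ≤ c := gaussianPDFReal_nonneg _ _ _
  refine ⟨4 * c ^ 2, by positivity, fun z s hs => ?_⟩
  have hIcc : ∀ a : ℝ, (gaussianReal 0 (1 / 2)).real (Set.Icc (a - s) (a + s)) ≤ 2 * s * c :=
    fun a => (gaussianReal_real_Icc_le 0 (by norm_num) (by linarith)).trans_eq (by ring)
  have hsub : Complex.measurableEquivRealProd.symm ⁻¹' Metric.closedBall z s ⊆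
      Set.Icc (z.re - s) (z.re + s) ×ˢ Set.Icc (z.im - s) (z.im + s) := by
    rintro ⟨x, y⟩ h
    rw [Set.mem_preimage, Metric.mem_closedBall, dist_eq_norm] at h
    have hre := abs_le.1 ((Complex.abs_re_le_norm _).trans h)
    have him := abs_le.1 ((Complex.abs_im_le_norm _).trans h)
    simp only [Complex.sub_re, Complex.sub_im, Complex.measurableEquivRealProd_symm_apply]
      at hre him
    exact ⟨⟨by linarith [hre.1], by linarith [hre.2]⟩, ⟨by linarith [him.1], by linarith [him.2]⟩⟩
  rw [stdComplexGaussian_real_apply Metric.isClosed_closedBall.measurableSet]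
  calc _ ≤ _ := measureReal_mono hsub
    _ ≤ (2 * s * c) * (2 * s * c) := by
        rw [measureReal_prod_prod]
        gcongr <;> exact hIcc _
    _ = 4 * c ^ 2 * s ^ 2 := by ring

lemma exists_le_stdComplexGaussian_closedBall : ∃ c : ℝ, 0 < c ∧ ∀ s : ℝ, 0 ≤ s → s ≤ 1 →
    c * s ^ 2 ≤ stdComplexGaussian.real (Metric.closedBall 0 s) := by
  set c : ℝ := gaussianPDFReal 0 (1 / 2) 1
  have hc : 0 < c := gaussianPDFReal_pos _ _ _ (by norm_num)
  refine ⟨c ^ 2, by positivity, fun s hs0 hs1 => ?_⟩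
  have hIcc : s * c ≤ (gaussianReal 0 (1 / 2)).real (Set.Icc (-(s / 2)) (s / 2)) :=
    (by ring : s * c = 2 * (s / 2) * c).trans_le
      (le_gaussianReal_real_Icc_neg (by norm_num) (by linarith) (by linarith))
  have hsub : Set.Icc (-(s / 2)) (s / 2) ×ˢ Set.Icc (-(s / 2)) (s / 2) ⊆
      Complex.measurableEquivRealProd.symm ⁻¹' Metric.closedBall 0 s := by
    rintro ⟨x, y⟩ ⟨hx, hy⟩
    rw [Set.mem_preimage, Metric.mem_closedBall, dist_zero_right]
    refine (Complex.norm_le_abs_re_add_abs_im _).trans ?_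
    simp only [Complex.measurableEquivRealProd_symm_apply]
    linarith [abs_le.2 hx, abs_le.2 hy]
  rw [stdComplexGaussian_real_apply Metric.isClosed_closedBall.measurableSet]
  calc c ^ 2 * s ^ 2 = (s * c) * (s * c) := by ring
    _ ≤ (gaussianReal 0 (1 / 2)).real (Set.Icc (-(s / 2)) (s / 2)) *
          (gaussianReal 0 (1 / 2)).real (Set.Icc (-(s / 2)) (s / 2)) := by gcongr
    _ ≤ _ := by
        rw [← measureReal_prod_prod]
        exact measureReal_mono hsub

lemma measureReal_pi_pi {ι : Type*} [Fintype ι] {α : ι → Type*} [∀ i, MeasurableSpace (α i)]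
    (μ : ∀ i, Measure (α i)) [∀ i, SigmaFinite (μ i)] (s : ∀ i, Set (α i)) :
    (Measure.pi μ).real (Set.univ.pi s) = ∏ i, (μ i).real (s i) := by
  simp only [measureReal_def, Measure.pi_pi, ENNReal.toReal_prod]

lemma measureReal_prod_le_of_section_le {α β : Type*} [MeasurableSpace α] [MeasurableSpace β]
    (μ : Measure α) (ν : Measure β) [IsFiniteMeasure μ] [IsProbabilityMeasure ν]
    {T : Set (α × β)} (hT : MeasurableSet T) {c : ℝ} (hc : 0 ≤ c)
    (h : ∀ y, μ.real ((fun x => (x, y)) ⁻¹' T) ≤ c) : (μ.prod ν).real T ≤ c := by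
  refine ENNReal.toReal_le_of_le_ofReal hc ?_
  rw [Measure.prod_apply_symm hT]
  calc ∫⁻ y, μ ((fun x => (x, y)) ⁻¹' T) ∂ν ≤ ∫⁻ _, ENNReal.ofReal c ∂ν :=
        lintegral_mono fun y => ENNReal.le_ofReal_iff_toReal_le (measure_ne_top _ _) hc |>.2 (h y)
    _ = ENNReal.ofReal c := by simp

variable {ι F : Type*} [Fintype ι] [NormedAddCommGroup F] [NormedSpace ℂ F]

lemma exists_pi_norm_sum_smul_add_le {v : ι → F} (hv : LinearIndependent ℂ v) :
    ∃ C : ℝ, 0 ≤ C ∧ ∀ (a : F) (s : ℝ), 0 ≤ s →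
      (Measure.pi fun _ : ι => stdComplexGaussian).real {g | ‖∑ i, g i • v i + a‖ ≤ s} ≤
        C * s ^ (2 * Fintype.card ι) := by
  obtain ⟨C, hC, hball⟩ := exists_stdComplexGaussian_closedBall_le
  obtain ⟨κ, -, hκ⟩ := (Fintype.linearCombination ℂ v).exists_antilipschitzWith
    (LinearMap.ker_eq_bot.2 (linearIndependent_iff_injective_fintypeLinearCombination.1 hv))
  refine ⟨(C * (κ * 2) ^ 2) ^ Fintype.card ι, by positivity, fun a s hs => ?_⟩
  rcases Set.eq_empty_or_nonempty {g : ι → ℂ | ‖∑ i, g i • v i + a‖ ≤ s} with he | ⟨g₀, hg₀⟩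
  · rw [he, measureReal_empty]
    positivity
  have hsub : {g : ι → ℂ | ‖∑ i, g i • v i + a‖ ≤ s} ⊆
      Set.univ.pi fun i => Metric.closedBall (g₀ i) (κ * (2 * s)) := by
    intro g hg
    rw [← closedBall_pi _ (by positivity)]
    refine (hκ.le_mul_dist g g₀).trans ?_
    gcongr
    rw [dist_eq_norm, Fintype.linearCombination_apply, Fintype.linearCombination_apply,
      ← add_sub_add_right_eq_sub _ _ a, two_mul]
    exact (norm_sub_le _ _).trans (add_le_add hg hg₀)
  calc _ ≤ _ := measureReal_mono hsub
    _ ≤ ∏ _ : ι, C * (κ * (2 * s)) ^ 2 := by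
        rw [measureReal_pi_pi]
        exact Finset.prod_le_prod (fun _ _ => measureReal_nonneg) fun i _ =>
          hball _ _ (by positivity)
    _ = _ := by
        rw [Finset.prod_const, Finset.card_univ, pow_mul, ← mul_pow]
        ring

lemma exists_pi_norm_sum_smul_le_of_linearIndepOn {v : ι → F} {T : Set ι}
    (hT : LinearIndepOn ℂ v T) : ∃ C : ℝ, 0 ≤ C ∧ ∀ s : ℝ, 0 ≤ s →
      (Measure.pi fun _ : ι => stdComplexGaussian).real {g | ‖∑ i, g i • v i‖ ≤ s} ≤
        C * s ^ (2 * Nat.card T) := by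
  classical
  obtain ⟨C, hC, h⟩ := exists_pi_norm_sum_smul_add_le hT
  refine ⟨C, hC, fun s hs => ?_⟩
  let E : Set ((T → ℂ) × ({i // i ∉ T} → ℂ)) :=
    {p | ‖∑ i, p.1 i • v i + ∑ i : {i // i ∉ T}, p.2 i • v i‖ ≤ s}
  have hE : MeasurableSet E := (isClosed_le (by fun_prop) continuous_const).measurableSet
  have hpre : {g : ι → ℂ | ‖∑ i, g i • v i‖ ≤ s} =
      MeasurableEquiv.piEquivPiSubtypeProd (fun _ => ℂ) (· ∈ T) ⁻¹' E := by
    ext g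
    simp only [Set.mem_ofPred_eq, Set.mem_preimage, E,
      ← Fintype.sum_subtype_add_sum_subtype (· ∈ T)]
    rfl
  rw [hpre, (measurePreserving_piEquivPiSubtypeProd (fun _ => stdComplexGaussian)
    (· ∈ T)).measureReal_preimage hE.nullMeasurableSet, Nat.card_eq_fintype_card]
  exact measureReal_prod_le_of_section_le _ _ hE (by positivity) fun y =>
    h (∑ i : {i // i ∉ T}, y i • v i) s hs

lemma exists_pi_norm_sum_smul_le (v : ι → F) : ∃ C : ℝ, 0 ≤ C ∧ ∀ s : ℝ, 0 ≤ s →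
    (Measure.pi fun _ : ι => stdComplexGaussian).real {g | ‖∑ i, g i • v i‖ ≤ s} ≤
      C * s ^ (2 * Module.finrank ℂ (Submodule.span ℂ (Set.range v))) := by
  obtain ⟨κ, b, hb, hspan, hli⟩ := exists_linearIndependent' ℂ v
  have : Finite κ := Finite.of_injective b hb
  have : Fintype κ := Fintype.ofFinite κ
  have hcard : Nat.card (Set.range b) = Module.finrank ℂ (Submodule.span ℂ (Set.range v)) := by
    rw [Nat.card_range_of_injective hb, Nat.card_eq_fintype_card, ← hspan,
      finrank_span_eq_card hli]
  rw [← hcard]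
  exact exists_pi_norm_sum_smul_le_of_linearIndepOn ((linearIndepOn_range_iff hb v).2 hli)

end SmallBall

/-! ## Outage exponents of one round -/

section DimensionLoss

/-- The law of the fading matrix of one block. -/
def blockLaw (Nr Nt : ℕ) : Measure (Fin Nr → Fin Nt → ℂ) :=
  Measure.pi fun _ => Measure.pi fun _ => stdComplexGaussian

instance (Nr Nt : ℕ) : IsProbabilityMeasure (blockLaw Nr Nt) := by
  unfold blockLaw
  infer_instance

/-- The gain matrix of a block with fading matrix `h` when the total power `p` is divided equally
among the transmit antennas. -/
def gainMatrix {Nr Nt : ℕ} (p : ℝ) (h : Fin Nr → Fin Nt → ℂ) : Matrix (Fin Nr) (Fin Nt) ℂ :=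
  ((√(p / Nt) : ℝ) : ℂ) • Matrix.of h

lemma roundLaw_eq_pi_blockLaw (B Nr Nt : ℕ) :
    roundLaw B Nr Nt = Measure.pi fun _ => blockLaw Nr Nt := rfl

lemma roundInfo_eq_gainMatrix (𝒳 : Finset ℂ) {B Nr Nt : ℕ} (p : ℝ) (h : RoundGain B Nr Nt) :
    roundInfo 𝒳 p h = (B : ℝ)⁻¹ * ∑ b, mutualInfo 𝒳 (gainMatrix p (h b)) := rfl

variable {𝒳 : Finset ℂ} {Nr Nt : ℕ} {A : ℝ}

lemma exists_linearIndependent_codeDiff {k : ℕ} {G : Matrix (Fin Nr) (Fin Nt) ℂ}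
    (hk : k ≤ lostDim 𝒳 A G) : ∃ q : Fin k → (Fin Nt → 𝒳) × (Fin Nt → 𝒳),
      LinearIndependent ℂ (fun j => codeDiff (q j).1 (q j).2) ∧
      ∀ j, sqNorm (G.mulVec (codeDiff (q j).1 (q j).2)) < A := by
  obtain ⟨d, hd, -, hli⟩ := Submodule.exists_fun_fin_finrank_span_eq ℂ
    {d | (∃ x x' : Fin Nt → 𝒳, d = codeDiff x x') ∧ sqNorm (G.mulVec d) < A}
  choose x x' hx using fun j => (hd j).1
  have hdx : d = fun j => codeDiff (x j) (x' j) := funext hx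
  subst hdx
  exact ⟨fun j => (x (Fin.castLE hk j), x' (Fin.castLE hk j)),
    hli.comp _ (Fin.castLE_injective hk), fun j => (hd (Fin.castLE hk j)).2⟩

lemma exists_pi_norm_dotProduct_le {ι κ : Type*} [Fintype ι] [Fintype κ] {d : κ → ι → ℂ}
    (hd : LinearIndependent ℂ d) : ∃ C : ℝ, 0 ≤ C ∧ ∀ s : ℝ, 0 ≤ s →
      (Measure.pi fun _ : ι => stdComplexGaussian).real {g | ∀ j, ‖g ⬝ᵥ d j‖ ≤ s} ≤
        C * s ^ (2 * Fintype.card κ) := by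
  obtain ⟨C, hC, h⟩ := exists_pi_norm_sum_smul_le fun (i : ι) (j : κ) => d j i
  have hrank : Module.finrank ℂ (Submodule.span ℂ (Set.range fun (i : ι) (j : κ) => d j i)) =
      Fintype.card κ :=
    (Matrix.rank_eq_finrank_span_cols (Matrix.of d)).symm.trans hd.rank_matrix
  refine ⟨C, hC, fun s hs => ?_⟩
  simpa only [hrank, pi_norm_le_iff_of_nonneg hs, Finset.sum_apply, Pi.smul_apply, smul_eq_mul,
    dotProduct] using h s hs

lemma exists_blockLaw_norm_dotProduct_le (Nr : ℕ) {κ : Type*} [Fintype κ] {d : κ → Fin Nt → ℂ}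
    (hd : LinearIndependent ℂ d) : ∃ C : ℝ, 0 ≤ C ∧ ∀ s : ℝ, 0 ≤ s →
      (blockLaw Nr Nt).real {h | ∀ r j, ‖h r ⬝ᵥ d j‖ ≤ s} ≤
        (C * s ^ (2 * Fintype.card κ)) ^ Nr := by
  obtain ⟨C, hC, h⟩ := exists_pi_norm_dotProduct_le hd
  refine ⟨C, hC, fun s hs => ?_⟩
  have hpi : {h : Fin Nr → Fin Nt → ℂ | ∀ r j, ‖h r ⬝ᵥ d j‖ ≤ s} =
      Set.univ.pi fun _ => {g | ∀ j, ‖g ⬝ᵥ d j‖ ≤ s} := by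
    ext
    simp
  rw [hpi, blockLaw, measureReal_pi_pi, Finset.prod_const, Finset.card_univ, Fintype.card_fin]
  exact pow_le_pow_left₀ measureReal_nonneg (h s hs) Nr

lemma norm_dotProduct_le_of_sqNorm_gainMatrix_le (hNt : 0 < Nt) {p : ℝ} (hp : 0 < p)
    {h : Fin Nr → Fin Nt → ℂ} {d : Fin Nt → ℂ} (hd : sqNorm ((gainMatrix p h).mulVec d) ≤ A)
    (r : Fin Nr) : ‖h r ⬝ᵥ d‖ ≤ √(A * Nt / p) := by
  have hNt' : (0 : ℝ) < Nt := by exact_mod_cast hNt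
  have hr : ‖(gainMatrix p h).mulVec d r‖ ^ 2 ≤ A :=
    (Finset.single_le_sum (f := fun r => ‖(gainMatrix p h).mulVec d r‖ ^ 2)
      (fun _ _ => by positivity) (Finset.mem_univ r)).trans hd
  have hentry : (gainMatrix p h).mulVec d r = ((√(p / Nt) : ℝ) : ℂ) * (h r ⬝ᵥ d) := by
    rw [gainMatrix, Matrix.smul_mulVec]
    rfl
  rw [hentry, norm_mul, mul_pow, Complex.norm_real, Real.norm_of_nonneg (Real.sqrt_nonneg _),
    Real.sq_sqrt (by positivity), div_mul_eq_mul_div, div_le_iff₀ hNt'] at hr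
  refine Real.le_sqrt_of_sq_le ?_
  rw [le_div_iff₀ hp]
  linarith

lemma exists_blockLaw_lostDim_le (𝒳 : Finset ℂ) (Nr : ℕ) (hNt : 0 < Nt) (hA : 0 ≤ A) (k : ℕ) :
    ∃ C : ℝ, 0 ≤ C ∧ ∀ p : ℝ, 0 < p →
      (blockLaw Nr Nt).real {h | k ≤ lostDim 𝒳 A (gainMatrix p h)} ≤ C * (p ^ (Nr * k))⁻¹ := by
  classical
  let Family := {q : Fin k → (Fin Nt → 𝒳) × (Fin Nt → 𝒳) //
    LinearIndependent ℂ fun j => codeDiff (q j).1 (q j).2}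
  choose C hC0 hC using fun q : Family => exists_blockLaw_norm_dotProduct_le Nr q.2
  refine ⟨∑ q, (C q * (A * Nt) ^ k) ^ Nr,
    Finset.sum_nonneg fun q _ => pow_nonneg (mul_nonneg (hC0 q) (by positivity)) _,
    fun p hp => ?_⟩
  have hsub : {h : Fin Nr → Fin Nt → ℂ | k ≤ lostDim 𝒳 A (gainMatrix p h)} ⊆
      ⋃ q : Family, {h | ∀ r j, ‖h r ⬝ᵥ codeDiff (q.1 j).1 (q.1 j).2‖ ≤ √(A * Nt / p)} := by
    intro h hh
    obtain ⟨q, hq, hlt⟩ := exists_linearIndependent_codeDiff hh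
    exact Set.mem_iUnion.2 ⟨⟨q, hq⟩, fun r j =>
      norm_dotProduct_le_of_sqNorm_gainMatrix_le hNt hp (hlt j).le r⟩
  have hpow : √(A * Nt / p) ^ (2 * Fintype.card (Fin k)) = (A * Nt) ^ k * (p ^ k)⁻¹ := by
    rw [Fintype.card_fin, pow_mul, Real.sq_sqrt (by positivity), div_pow, div_eq_mul_inv]
  calc _ ≤ _ := measureReal_mono hsub (measure_ne_top _ _)
    _ ≤ _ := measureReal_iUnion_fintype_le _
    _ ≤ ∑ q : Family, (C q * (A * Nt) ^ k) ^ Nr * (p ^ (Nr * k))⁻¹ := by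
        refine Finset.sum_le_sum fun q _ => (hC q _ (Real.sqrt_nonneg _)).trans_eq ?_
        rw [hpow, ← mul_assoc, mul_pow, inv_pow, ← pow_mul, mul_comm k Nr]
    _ = _ := (Finset.sum_mul ..).symm

lemma exists_forall_blockLaw_lostDim_le (𝒳 : Finset ℂ) (Nr : ℕ) (hNt : 0 < Nt) (hA : 0 ≤ A) :
    ∃ C : ℝ, 0 ≤ C ∧ ∀ (k : ℕ) (p : ℝ), 0 < p →
      (blockLaw Nr Nt).real {h | k ≤ lostDim 𝒳 A (gainMatrix p h)} ≤ C * (p ^ (Nr * k))⁻¹ := by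
  choose C hC0 hC using exists_blockLaw_lostDim_le (A := A) 𝒳 Nr hNt hA
  refine ⟨∑ k ∈ Finset.range (Nt + 1), C k, Finset.sum_nonneg fun k _ => hC0 k, fun k p hp => ?_⟩
  rcases le_or_gt k Nt with hk | hk
  · refine (hC k p hp).trans ?_
    gcongr
    exact Finset.single_le_sum (fun k _ => hC0 k) (Finset.mem_range_succ_iff.2 hk)
  · have hempty : {h : Fin Nr → Fin Nt → ℂ | k ≤ lostDim 𝒳 A (gainMatrix p h)} = ∅ :=
      Set.eq_empty_of_forall_notMem fun h hh => (hh.trans (lostDim_le _ A)).not_gt hk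
    rw [hempty, measureReal_empty]
    exact mul_nonneg (Finset.sum_nonneg fun k _ => hC0 k) (by positivity)

lemma pi_real_le_sum_le {ι α : Type*} [Fintype ι] [MeasurableSpace α] (ν : Measure α)
    [IsProbabilityMeasure ν] {X : α → ℕ} {N : ℕ} (hX : ∀ a, X a ≤ N) {C q : ℝ} (hq0 : 0 ≤ q)
    (hq1 : q ≤ 1) (hC : 0 ≤ C) (h : ∀ k, ν.real {a | k ≤ X a} ≤ C * q ^ k) (D : ℕ) :
    (Measure.pi fun _ : ι => ν).real {a | D ≤ ∑ i, X (a i)} ≤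
      ((N + 1) * C) ^ Fintype.card ι * q ^ D := by
  classical
  let s : Finset (ι → Fin (N + 1)) := {κ | D ≤ ∑ i, (κ i : ℕ)}
  have hsub : {a : ι → α | D ≤ ∑ i, X (a i)} ⊆
      ⋃ κ ∈ s, Set.univ.pi fun i => {a | (κ i : ℕ) ≤ X a} := fun a ha =>
    Set.mem_biUnion (Finset.mem_filter.2 ⟨Finset.mem_univ
      (fun i => ⟨X (a i), Nat.lt_succ_of_le (hX _)⟩ : ι → Fin (N + 1)), ha⟩)
      (Set.mem_univ_pi.2 fun i => le_refl (X (a i)))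
  have hκ : ∀ κ ∈ s, (Measure.pi fun _ : ι => ν).real
      (Set.univ.pi fun i => {a | (κ i : ℕ) ≤ X a}) ≤ C ^ Fintype.card ι * q ^ D := by
    intro κ hκ
    rw [measureReal_pi_pi]
    calc ∏ i, ν.real {a | (κ i : ℕ) ≤ X a} ≤ ∏ i, C * q ^ (κ i : ℕ) :=
          Finset.prod_le_prod (fun _ _ => measureReal_nonneg) fun i _ => h (κ i)
      _ = C ^ Fintype.card ι * q ^ ∑ i, (κ i : ℕ) := by
          rw [Finset.prod_mul_distrib, Finset.prod_const, Finset.card_univ,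
            Finset.prod_pow_eq_pow_sum]
      _ ≤ _ := mul_le_mul_of_nonneg_left
          (pow_le_pow_of_le_one hq0 hq1 (Finset.mem_filter.1 hκ).2) (by positivity)
  calc _ ≤ _ := measureReal_mono hsub (measure_ne_top _ _)
    _ ≤ _ := measureReal_biUnion_finset_le _ _
    _ ≤ s.card * (C ^ Fintype.card ι * q ^ D) := by
        rw [← nsmul_eq_mul]
        exact Finset.sum_le_card_nsmul _ _ _ hκ
    _ ≤ (N + 1) ^ Fintype.card ι * (C ^ Fintype.card ι * q ^ D) := by
        gcongr
        exact_mod_cast (Finset.card_le_univ s).trans_eq (by simp)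
    _ = _ := by rw [mul_pow, mul_assoc]

end DimensionLoss

section RoundInfo

variable {𝒳 : Finset ℂ} {B Nr Nt : ℕ} {M : ℝ}

lemma sub_le_sum_lostDim_of_roundInfo_lt (hB : 0 < B) (hM0 : 0 < M) {A δ p : ℝ}
    (hA : ∀ G : Matrix (Fin Nr) (Fin Nt) ℂ,
      ((Nt : ℝ) - lostDim 𝒳 A G) * M - δ ≤ mutualInfo 𝒳 G)
    {h : RoundGain B Nr Nt} {i : ℕ} (hi : roundInfo 𝒳 p h < (i + 1) * (M / B) - δ) :
    B * Nt - i ≤ ∑ b, lostDim 𝒳 A (gainMatrix p (h b)) := by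
  have hB' : (0 : ℝ) < B := by exact_mod_cast hB
  have hsum := Finset.sum_le_sum fun b (_ : b ∈ Finset.univ) => hA (gainMatrix p (h b))
  rw [roundInfo_eq_gainMatrix, inv_mul_lt_iff₀ hB'] at hi
  simp only [Finset.sum_sub_distrib, ← Finset.sum_mul, Finset.sum_const, Finset.card_univ,
    Fintype.card_fin, nsmul_eq_mul] at hsum
  have hi' : (B : ℝ) * ((i + 1) * (M / B) - δ) = (i + 1) * M - B * δ := by field_simp
  have hlt : (B : ℝ) * Nt - ∑ b, (lostDim 𝒳 A (gainMatrix p (h b)) : ℝ) < i + 1 := by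
    refine lt_of_mul_lt_mul_right ?_ hM0.le
    linarith
  have hlt' : B * Nt < i + 1 + ∑ b, lostDim 𝒳 A (gainMatrix p (h b)) := by
    rw [← Nat.cast_lt (α := ℝ)]
    push_cast
    linarith
  lia

lemma exists_roundLaw_roundInfo_lt_le (Nr : ℕ) (hB : 0 < B) (hNt : 0 < Nt)
    (hM : (𝒳.card : ℝ) = (2 : ℝ) ^ M) (hM0 : 0 < M) {δ : ℝ} (hδ : 0 < δ) :
    ∃ C : ℝ, 1 ≤ C ∧ ∀ p : ℝ, 0 < p → ∀ i : ℕ,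
      (roundLaw B Nr Nt).real {h | roundInfo 𝒳 p h < (i + 1) * (M / B) - δ} ≤
        C * (p ^ (Nr * (B * Nt - i)))⁻¹ := by
  obtain ⟨A, hA, hinfo⟩ := exists_sub_lostDim_mul_sub_le_mutualInfo (𝒳 := 𝒳) Nr Nt hM hδ
  obtain ⟨C, hC, hlost⟩ := exists_forall_blockLaw_lostDim_le 𝒳 Nr hNt hA.le
  refine ⟨max 1 (((Nt + 1) * C) ^ B), le_max_left _ _, fun p hp i => ?_⟩
  rcases lt_or_ge p 1 with hp1 | hp1
  · refine measureReal_le_one.trans (one_le_mul_of_one_le_of_one_le (le_max_left _ _) ?_)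
    exact one_le_inv_iff₀.2 ⟨by positivity, pow_le_one₀ hp.le hp1.le⟩
  have hpow : ∀ k, ((p ^ Nr)⁻¹) ^ k = (p ^ (Nr * k))⁻¹ := fun k => by rw [inv_pow, ← pow_mul]
  have hsum := pi_real_le_sum_le (ι := Fin B) (blockLaw Nr Nt)
    (fun h => lostDim_le (𝒳 := 𝒳) (gainMatrix p h) A) (q := (p ^ Nr)⁻¹) (by positivity)
    (inv_le_one_of_one_le₀ (one_le_pow₀ hp1)) hC
    (fun k => (hlost k p hp).trans_eq (by rw [hpow])) (B * Nt - i)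
  rw [hpow, Fintype.card_fin, ← roundLaw_eq_pi_blockLaw] at hsum
  calc _ ≤ _ := measureReal_mono fun h => sub_le_sum_lostDim_of_roundInfo_lt hB hM0 hinfo
    _ ≤ _ := hsum
    _ ≤ _ := by
        gcongr
        exact le_max_right _ _

lemma sum_card_filter_prodMk_mem {α β : Type*} [Fintype α] [Fintype β] [DecidableEq α]
    [DecidableEq β] (T : Finset (α × β)) :
    ∑ a, (Finset.univ.filter fun b => (a, b) ∈ T).card = T.card := by
  simp_rw [Finset.card_filter]
  rw [← Fintype.sum_prod_type' fun a b => if (a, b) ∈ T then 1 else 0]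
  simp

/-- The event that the gains of the antennas and blocks in `T` have modulus at most `s`. -/
def deepFade (Nr : ℕ) (T : Finset (Fin B × Fin Nt)) (s : ℝ) : Set (RoundGain B Nr Nt) :=
  {h | ∀ b r t, (b, t) ∈ T → ‖h b r t‖ ≤ s}

lemma roundLaw_real_deepFade (T : Finset (Fin B × Fin Nt)) (s : ℝ) :
    (roundLaw B Nr Nt).real (deepFade Nr T s) =
      stdComplexGaussian.real (Metric.closedBall 0 s) ^ (Nr * T.card) := by
  classical
  let ball : Fin B → Fin Nt → Set ℂ := fun b t =>
    if (b, t) ∈ T then Metric.closedBall 0 s else Set.univ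
  have hpi : deepFade Nr T s =
      Set.univ.pi fun b => Set.univ.pi fun _ => Set.univ.pi fun t => ball b t := by
    ext h
    simp only [deepFade, Set.mem_ofPred_eq, Set.mem_univ_pi, ball]
    refine forall_congr' fun b => forall_congr' fun r => forall_congr' fun t => ?_
    split_ifs with ht <;> simp [ht]
  have hball : ∀ b t, stdComplexGaussian.real (ball b t) =
      if (b, t) ∈ T then stdComplexGaussian.real (Metric.closedBall 0 s) else 1 := fun b t => by
    simp only [ball]
    split_ifs
    exacts [rfl, probReal_univ]
  simp only [hpi, roundLaw, measureReal_pi_pi, hball, Finset.prod_ite, Finset.prod_const,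
    Finset.card_univ, Fintype.card_fin, one_pow, mul_one]
  rw [Finset.prod_pow, Finset.prod_pow_eq_pow_sum, sum_card_filter_prodMk_mem, ← pow_mul,
    mul_comm]

lemma roundInfo_le_of_mem_deepFade (hB : 0 < B) {ρ η p s : ℝ}
    (hinfo : ∀ (G : Matrix (Fin Nr) (Fin Nt) ℂ) (T : Finset (Fin Nt)),
      (∀ r, ∀ t ∈ T, ‖G r t‖ ≤ ρ) → mutualInfo 𝒳 G ≤ ((Nt : ℝ) - T.card) * M + η)
    {T : Finset (Fin B × Fin Nt)} (hs : √(p / Nt) * s ≤ ρ) {h : RoundGain B Nr Nt}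
    (hh : h ∈ deepFade Nr T s) :
    roundInfo 𝒳 p h ≤ ((B : ℝ) * Nt - T.card) * (M / B) + η := by
  classical
  have hB' : (0 : ℝ) < B := by exact_mod_cast hB
  have hblock : ∀ b, mutualInfo 𝒳 (gainMatrix p (h b)) ≤
      ((Nt : ℝ) - (Finset.univ.filter fun t => (b, t) ∈ T).card) * M + η := by
    refine fun b => hinfo _ _ fun r t ht => ?_
    rw [gainMatrix, Matrix.smul_apply, Matrix.of_apply, norm_smul, Complex.norm_real,
      Real.norm_of_nonneg (Real.sqrt_nonneg _)]
    exact (mul_le_mul_of_nonneg_left (hh b r t (Finset.mem_filter.1 ht).2)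
      (Real.sqrt_nonneg _)).trans hs
  have hsum := Finset.sum_le_sum fun b (_ : b ∈ Finset.univ) => hblock b
  rw [Finset.sum_add_distrib, ← Finset.sum_mul, Finset.sum_sub_distrib,
    ← Nat.cast_sum Finset.univ fun b : Fin B => (Finset.univ.filter fun t => (b, t) ∈ T).card,
    sum_card_filter_prodMk_mem] at hsum
  simp only [Finset.sum_const, Finset.card_univ, Fintype.card_fin, nsmul_eq_mul] at hsum
  rw [roundInfo_eq_gainMatrix, inv_mul_le_iff₀ hB']
  refine hsum.trans_eq ?_
  field_simp

lemma exists_le_roundLaw_roundInfo_le (Nr : ℕ) (hB : 0 < B) (hNt : 0 < Nt)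
    (hM : (𝒳.card : ℝ) = (2 : ℝ) ^ M) {η : ℝ} (hη : 0 < η) {D : ℕ} (hD : D ≤ B * Nt) :
    ∃ c : ℝ, 0 < c ∧ ∀ x : ℝ, 1 ≤ x → ∀ p : ℝ, 0 ≤ p → p ≤ x →
      c * (x ^ (Nr * D))⁻¹ ≤ (roundLaw B Nr Nt).real
        {h | roundInfo 𝒳 p h ≤ ((B : ℝ) * Nt - D) * (M / B) + η} := by
  obtain ⟨ρ, hρ, hinfo⟩ := exists_mutualInfo_le_sub_card_mul_add (𝒳 := 𝒳) Nr Nt hM hη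
  obtain ⟨c, hc, hball⟩ := exists_le_stdComplexGaussian_closedBall
  obtain ⟨T, -, rfl⟩ : ∃ T ⊆ (Finset.univ : Finset (Fin B × Fin Nt)), T.card = D :=
    Finset.exists_subset_card_eq (by simpa using hD)
  set σ := min ρ 1
  have hσ : 0 < σ := lt_min hρ one_pos
  refine ⟨(c * σ ^ 2) ^ (Nr * T.card), by positivity, fun x hx p hp0 hpx => ?_⟩
  have hx0 : 0 < x := one_pos.trans_le hx
  have hNt' : (1 : ℝ) ≤ Nt := by exact_mod_cast hNt
  have hs1 : σ / √x ≤ 1 :=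
    (div_le_one (by positivity)).2 ((min_le_right _ _).trans (Real.one_le_sqrt.2 hx))
  have hsρ : √(p / Nt) * (σ / √x) ≤ ρ :=
    calc √(p / Nt) * (σ / √x) ≤ √x * (σ / √x) := by
          gcongr
          exact (div_le_self hp0 hNt').trans hpx
      _ = σ := by field_simp
      _ ≤ ρ := min_le_left _ _
  calc (c * σ ^ 2) ^ (Nr * T.card) * (x ^ (Nr * T.card))⁻¹
      = (c * (σ / √x) ^ 2) ^ (Nr * T.card) := by
        rw [div_pow, Real.sq_sqrt hx0.le, ← inv_pow, ← mul_pow, mul_assoc, div_eq_mul_inv]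
    _ ≤ (roundLaw B Nr Nt).real (deepFade Nr T (σ / √x)) := by
        rw [roundLaw_real_deepFade]
        exact pow_le_pow_left₀ (by positivity) (hball _ (by positivity) hs1) _
    _ ≤ _ := measureReal_mono fun h => roundInfo_le_of_mem_deepFade hB hinfo hsρ

lemma roundInfo_nonneg (h𝒳 : 0 < 𝒳.card) (p : ℝ) (h : RoundGain B Nr Nt) : 0 ≤ roundInfo 𝒳 p h :=
  mul_nonneg (by positivity) (Finset.sum_nonneg fun _ _ => mutualInfo_nonneg _ h𝒳)

lemma measurable_roundInfo (𝒳 : Finset ℂ) (p : ℝ) :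
    Measurable fun h : RoundGain B Nr Nt => roundInfo 𝒳 p h := by
  refine (Finset.measurable_sum _ fun b _ => measurable_mutualInfo fun r t => ?_).const_mul _
  simp only [Matrix.smul_apply, Matrix.of_apply]
  fun_prop

end RoundInfo

/-! ## Measurability and independence of the rounds -/

lemma measurable_comp_of_countable {α β γ δ : Type*} [MeasurableSpace α] [MeasurableSpace β]
    [MeasurableSpace γ] [MeasurableSpace δ] [Countable β] [MeasurableSingletonClass β]
    {f : β → γ → δ} (hf : ∀ b, Measurable (f b)) {u : α → β} {v : α → γ} (hu : Measurable u)
    (hv : Measurable v) : Measurable fun a => f (u a) (v a) :=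
  (measurable_from_prod_countable_right hf : Measurable (Function.uncurry f)).comp (hu.prodMk hv)

lemma infinitePi_real_inter_eq_mul {ι : Type*} {Ω : ι → Type*} [∀ i, MeasurableSpace (Ω i)]
    (μ : ∀ i, Measure (Ω i)) [∀ i, IsProbabilityMeasure (μ i)] {s : Finset ι} {i : ι}
    (hi : i ∉ s) {E : Set (∀ i, Ω i)} (hE : MeasurableSet E) (hEs : DependsOn (· ∈ E) (s : Set ι))
    {T : Set (Ω i)} (hT : MeasurableSet T) :
    (Measure.infinitePi μ).real (E ∩ {x | x i ∈ T}) =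
      (Measure.infinitePi μ).real E * (μ i).real T := by
  classical
  obtain ⟨x₀⟩ := (Measure.infinitePi μ).nonempty_of_neZero
  have hind := (iIndepFun_infinitePi (P := μ) (X := fun _ x => x)
    fun _ => measurable_id).indepFun_finset s {i} (Finset.disjoint_singleton_right.2 hi)
    fun i => measurable_pi_apply i
  have hpre : (fun (x : ∀ i, Ω i) (j : s) => x j) ⁻¹' (Function.updateFinset x₀ s ⁻¹' E) = E := by
    ext x
    refine iff_of_eq (hEs fun j hj => ?_)
    simp [Function.updateFinset, Finset.mem_coe.1 hj]
  have hmul := hind.measure_inter_preimage_eq_mul _ {g | g ⟨i, Finset.mem_singleton_self i⟩ ∈ T}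
    ((measurable_updateFinset (x := x₀)) hE)
    (measurable_pi_apply (⟨i, Finset.mem_singleton_self i⟩ : ({i} : Finset ι)) hT)
  have hmarg : Measure.infinitePi μ {x | x i ∈ T} = μ i T :=
    (measurePreserving_eval_infinitePi μ i).measure_preimage hT.nullMeasurableSet
  rw [hpre] at hmul
  rw [measureReal_def, measureReal_def, measureReal_def, ← hmarg, ← ENNReal.toReal_mul]
  exact congrArg ENNReal.toReal hmul

instance (B Nr Nt : ℕ) : IsProbabilityMeasure (fadingLaw B Nr Nt) := by
  unfold fadingLaw
  infer_instance

section System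

variable {𝒳 : Finset ℂ} {B Nr Nt K : ℕ} [NeZero K] {R : ℝ} {Q : Quantizer K} {S : PowerRule K}

lemma accInfo_zero (h : ℕ → RoundGain B Nr Nt) : accInfo 𝒳 R Q S h 0 = 0 := rfl

lemma accInfo_succ (h : ℕ → RoundGain B Nr Nt) (n : ℕ) : accInfo 𝒳 R Q S h (n + 1) =
    accInfo 𝒳 R Q S h n + roundInfo 𝒳 (S.power n (feedback 𝒳 R Q S h n)) (h n) := rfl

lemma feedback_succ (h : ℕ → RoundGain B Nr Nt) (n : ℕ) : feedback 𝒳 R Q S h (n + 1) =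
    Fin.snoc (α := fun _ => Fin K) (feedback 𝒳 R Q S h n)
      (feedbackIndex Q R (feedback 𝒳 R Q S h n) (accInfo 𝒳 R Q S h (n + 1))) := rfl

lemma dependsOn_state (n : ℕ) :
    DependsOn (fun h : ℕ → RoundGain B Nr Nt => state 𝒳 R Q S h n) (Finset.range n) := by
  intro h h' hh
  induction n with
  | zero => rfl
  | succ n ih =>
    have hn := ih fun i hi => hh i (by simp at hi ⊢; lia)
    simp only at hn
    simp only [state, hn, hh n (by simp)]

lemma measurable_feedbackIndex {n : ℕ} (fb : Fin n → Fin K) :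
    Measurable fun a : ℝ => feedbackIndex Q R fb a := by
  classical
  refine Measurable.ite measurableSet_Ici measurable_const ?_
  have hfind : Measurable fun a : ℝ => Nat.findGreatest (fun k => Q.thr n fb k ≤ a) (K - 2) :=
    measurable_findGreatest fun k _ => measurableSet_Ici
  refine measurable_to_countable' fun k => ?_
  convert hfind (measurableSet_singleton (k : ℕ)) using 1
  ext a
  simp [Fin.ext_iff]

lemma measurable_state (n : ℕ) :
    Measurable fun h : ℕ → RoundGain B Nr Nt => state 𝒳 R Q S h n := by
  induction n with
  | zero => exact measurable_const
  | succ n ih =>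
    have hinfo : Measurable fun h : ℕ → RoundGain B Nr Nt => (state 𝒳 R Q S h n).2 +
        roundInfo 𝒳 (S.power n (state 𝒳 R Q S h n).1) (h n) :=
      ih.snd.add (measurable_comp_of_countable (fun fb => measurable_roundInfo 𝒳 (S.power n fb))
        ih.fst (measurable_pi_apply n))
    have hindex := measurable_comp_of_countable
      (fun fb => measurable_feedbackIndex (R := R) (Q := Q) fb) ih.fst hinfo
    have hsnoc := measurable_comp_of_countable
      (f := fun (fb : Fin n → Fin K) k => (Fin.snoc (α := fun _ => Fin K) fb k : Fin (n + 1) → _))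
      (fun _ => Measurable.of_discrete) ih.fst hindex
    exact hsnoc.prodMk hinfo

lemma fadingLaw_real_state_inter {n : ℕ} {E : Set ((Fin n → Fin K) × ℝ)} (hE : MeasurableSet E)
    {T : Set (RoundGain B Nr Nt)} (hT : MeasurableSet T) :
    (fadingLaw B Nr Nt).real ({h | state 𝒳 R Q S h n ∈ E} ∩ {h | h n ∈ T}) =
      (fadingLaw B Nr Nt).real {h | state 𝒳 R Q S h n ∈ E} * (roundLaw B Nr Nt).real T :=
  infinitePi_real_inter_eq_mul _ (Finset.notMem_range_self (n := n)) (measurable_state n hE)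
    (fun _ _ hh => congrArg (· ∈ E) (dependsOn_state n hh)) hT

end System

/-! ## Converse -/

section Converse

variable {𝒳 : Finset ℂ} {B Nr Nt K L : ℕ} [NeZero K] {R M : ℝ} {Q : Quantizer K}
  {S : PowerRule K}

lemma feedbackProb_mul_power_le_averagePower {n : ℕ} (hn : n < L) (fb : Fin n → Fin K) :
    feedbackProb 𝒳 B Nr Nt R Q S fb * S.power n fb ≤ averagePower 𝒳 B Nr Nt R Q S L := by
  have hnonneg : ∀ (n : ℕ) (fb : Fin n → Fin K),
      0 ≤ feedbackProb 𝒳 B Nr Nt R Q S fb * S.power n fb :=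
    fun n fb => mul_nonneg measureReal_nonneg (S.power_nonneg n fb)
  calc _ ≤ ∑ fb : Fin n → Fin K, feedbackProb 𝒳 B Nr Nt R Q S fb * S.power n fb :=
        Finset.single_le_sum (fun fb _ => hnonneg n fb) (Finset.mem_univ fb)
    _ ≤ _ := Finset.single_le_sum
        (f := fun n => ∑ fb : Fin n → Fin K, feedbackProb 𝒳 B Nr Nt R Q S fb * S.power n fb)
        (fun n _ => Finset.sum_nonneg fun fb _ => hnonneg n fb) (Finset.mem_range.2 hn)

/-- The probability that the feedback vector is `fb` while the accumulated information is at most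
`a`. -/
def lowInfoProb (𝒳 : Finset ℂ) (B Nr Nt : ℕ) (R : ℝ) (Q : Quantizer K) (S : PowerRule K) {n : ℕ}
    (fb : Fin n → Fin K) (a : ℝ) : ℝ :=
  (fadingLaw B Nr Nt).real {h | feedback 𝒳 R Q S h n = fb ∧ accInfo 𝒳 R Q S h n ≤ a}

lemma power_le_div_lowInfoProb {P : ℝ} (hP : averagePower 𝒳 B Nr Nt R Q S L ≤ P) {n : ℕ}
    (hn : n < L) {fb : Fin n → Fin K} {a : ℝ} (hr : 0 < lowInfoProb 𝒳 B Nr Nt R Q S fb a) :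
    S.power n fb ≤ P / lowInfoProb 𝒳 B Nr Nt R Q S fb a := by
  rw [le_div_iff₀ hr, mul_comm]
  refine le_trans ?_ ((feedbackProb_mul_power_le_averagePower hn fb).trans hP)
  exact mul_le_mul_of_nonneg_right (measureReal_mono fun h => And.left) (S.power_nonneg n fb)

/- The feedback `fb` has probability at least `r = lowInfoProb fb a`, so the power constraint caps
the power used after it by `P / r`; fading this power away in `D` antenna-block pairs costs a factor
`(P / r) ^ (-Nr * D)`. -/
lemma exists_le_real_feedback_accInfo_succ (Nr : ℕ) (hB : 0 < B) (hNt : 0 < Nt)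
    (hM : (𝒳.card : ℝ) = (2 : ℝ) ^ M) {η : ℝ} (hη : 0 < η) {D : ℕ} (hD : D ≤ B * Nt) :
    ∃ c : ℝ, 0 < c ∧ ∀ {K L n : ℕ} [NeZero K] {R P a : ℝ} {Q : Quantizer K} {S : PowerRule K}
      {fb : Fin n → Fin K}, n < L → 1 ≤ P → averagePower 𝒳 B Nr Nt R Q S L ≤ P →
      0 < lowInfoProb 𝒳 B Nr Nt R Q S fb a →
      c * P * ((P / lowInfoProb 𝒳 B Nr Nt R Q S fb a) ^ (1 + Nr * D))⁻¹ ≤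
        (fadingLaw B Nr Nt).real {h | feedback 𝒳 R Q S h n = fb ∧
          accInfo 𝒳 R Q S h (n + 1) ≤ a + (((B : ℝ) * Nt - D) * (M / B) + η)} := by
  obtain ⟨c, hc, hround⟩ := exists_le_roundLaw_roundInfo_le (𝒳 := 𝒳) Nr hB hNt hM hη hD
  refine ⟨c, hc, fun {K L n} _ {R P a Q S fb} hn hP hav hr => ?_⟩
  set r := lowInfoProb 𝒳 B Nr Nt R Q S fb a
  have hx : 1 ≤ P / r := (one_le_div hr).2 (measureReal_le_one.trans hP)
  have hind := fadingLaw_real_state_inter (𝒳 := 𝒳) (R := R) (Q := Q) (S := S)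
    (E := {fb} ×ˢ Set.Iic a) ((measurableSet_singleton fb).prod measurableSet_Iic)
    (measurable_roundInfo (B := B) (Nr := Nr) (Nt := Nt) 𝒳 (S.power n fb)
      (measurableSet_Iic (a := ((B : ℝ) * Nt - D) * (M / B) + η)))
  calc c * P * ((P / r) ^ (1 + Nr * D))⁻¹ = r * (c * ((P / r) ^ (Nr * D))⁻¹) := by
        have : 0 < P := one_pos.trans_le hP
        rw [pow_add, pow_one]
        field_simp
    _ ≤ _ := mul_le_mul_of_nonneg_left
        (hround _ hx _ (S.power_nonneg n fb) (power_le_div_lowInfoProb hav hn hr)) hr.le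
    _ = _ := hind.symm
    _ ≤ _ := by
        refine measureReal_mono ?_
        rintro h ⟨⟨hfb, ha⟩, hT⟩
        have hfb : feedback 𝒳 R Q S h n = fb := hfb
        refine ⟨hfb, ?_⟩
        rw [accInfo_succ, hfb]
        exact add_le_add ha hT

lemma exists_lowInfoProb_snoc_ge {n : ℕ} (fb : Fin n → Fin K) (a : ℝ) : ∃ k : Fin K,
    (fadingLaw B Nr Nt).real {h | feedback 𝒳 R Q S h n = fb ∧ accInfo 𝒳 R Q S h (n + 1) ≤ a} / K ≤
      lowInfoProb 𝒳 B Nr Nt R Q S (Fin.snoc (α := fun _ => Fin K) fb k) a := by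
  have hsub : {h : ℕ → RoundGain B Nr Nt | feedback 𝒳 R Q S h n = fb ∧
      accInfo 𝒳 R Q S h (n + 1) ≤ a} ⊆ ⋃ k : Fin K, {h | feedback 𝒳 R Q S h (n + 1) =
        Fin.snoc (α := fun _ => Fin K) fb k ∧ accInfo 𝒳 R Q S h (n + 1) ≤ a} := by
    rintro h ⟨rfl, ha⟩
    exact Set.mem_iUnion.2 ⟨_, feedback_succ h n, ha⟩
  have hK : (K : ℝ) ≠ 0 := by exact_mod_cast NeZero.ne K
  obtain ⟨k, -, hk⟩ := Finset.exists_le_of_sum_le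
    (f := fun _ : Fin K => (fadingLaw B Nr Nt).real
      {h | feedback 𝒳 R Q S h n = fb ∧ accInfo 𝒳 R Q S h (n + 1) ≤ a} / K)
    (g := fun k => lowInfoProb 𝒳 B Nr Nt R Q S (Fin.snoc (α := fun _ => Fin K) fb k) a)
    (Finset.univ_nonempty) (by
      rw [Finset.sum_const, Finset.card_univ, Fintype.card_fin, nsmul_eq_mul, mul_div_cancel₀ _ hK]
      exact (measureReal_mono hsub).trans (measureReal_iUnion_fintype_le _))
  exact ⟨k, hk⟩

lemma exists_feedback_div_lowInfoProb_le (Nr : ℕ) (hB : 0 < B) (hNt : 0 < Nt)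
    (hM : (𝒳.card : ℝ) = (2 : ℝ) ^ M) (R : ℝ) (K : ℕ) [NeZero K] {η : ℝ} (hη : 0 < η) (n : ℕ) :
    ∃ A : ℝ, 0 < A ∧ ∀ (L : ℕ) (P : ℝ) (Q : Quantizer K) (S : PowerRule K), n < L → 1 ≤ P →
      averagePower 𝒳 B Nr Nt R Q S L ≤ P → ∃ fb : Fin n → Fin K,
        0 < lowInfoProb 𝒳 B Nr Nt R Q S fb (n * η) ∧
        P / lowInfoProb 𝒳 B Nr Nt R Q S fb (n * η) ≤ A * P ^ ((1 + Nr * (B * Nt)) ^ n) := by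
  induction n with
  | zero =>
    refine ⟨1, one_pos, fun L P Q S _ _ _ => ⟨Fin.elim0, ?_⟩⟩
    have hone : lowInfoProb 𝒳 B Nr Nt R Q S (Fin.elim0 : Fin 0 → Fin K) ((0 : ℕ) * η) = 1 := by
      simp [lowInfoProb, accInfo_zero, eq_iff_true_of_subsingleton]
    rw [hone]
    simp
  | succ n ih =>
    obtain ⟨A, hA, ih⟩ := ih
    obtain ⟨c, hc, hstep⟩ := exists_le_real_feedback_accInfo_succ Nr hB hNt hM hη (le_refl (B * Nt))
    have hK : (0 : ℝ) < K := by exact_mod_cast NeZero.pos K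
    refine ⟨K / c * A ^ (1 + Nr * (B * Nt)), by positivity, fun L P Q S hn hP hav => ?_⟩
    have hP0 : 0 < P := one_pos.trans_le hP
    obtain ⟨fb, hr, hx⟩ := ih L P Q S (by lia) hP hav
    obtain ⟨k, hk⟩ := exists_lowInfoProb_snoc_ge (𝒳 := 𝒳) (B := B) (Nr := Nr) (Nt := Nt) (R := R)
      (Q := Q) (S := S) fb (n * η + (((B : ℝ) * Nt - (B * Nt : ℕ)) * (M / B) + η))
    have hinfo : n * η + (((B : ℝ) * Nt - (B * Nt : ℕ)) * (M / B) + η) = (n + 1 : ℕ) * η := by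
      push_cast
      ring
    have hge := (div_le_div_of_nonneg_right (hstep (by lia) hP hav hr) hK.le).trans hk
    rw [hinfo] at hge
    have hpos : 0 < c * P * ((P / lowInfoProb 𝒳 B Nr Nt R Q S fb (n * η)) ^
        (1 + Nr * (B * Nt)))⁻¹ / K := by positivity
    refine ⟨Fin.snoc (α := fun _ => Fin K) fb k, hpos.trans_le hge, ?_⟩
    calc _ ≤ _ := div_le_div_of_nonneg_left hP0.le hpos hge
      _ = K / c * (P / lowInfoProb 𝒳 B Nr Nt R Q S fb (n * η)) ^ (1 + Nr * (B * Nt)) := by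
          field_simp
      _ ≤ K / c * (A * P ^ ((1 + Nr * (B * Nt)) ^ n)) ^ (1 + Nr * (B * Nt)) := by gcongr
      _ = _ := by rw [mul_pow, ← pow_mul, ← pow_succ, mul_assoc]

lemma exists_le_outageProb (Nr : ℕ) (hB : 0 < B) (hNt : 0 < Nt) (hM : (𝒳.card : ℝ) = (2 : ℝ) ^ M)
    (K : ℕ) [NeZero K] {J : ℕ} (hJ : J ≤ B * Nt) (hJR : J * (M / B) < R) (n : ℕ) :
    ∃ c : ℝ, 0 < c ∧ ∀ (L : ℕ) (P : ℝ) (Q : Quantizer K) (S : PowerRule K), n < L → 1 ≤ P →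
      averagePower 𝒳 B Nr Nt R Q S L ≤ P →
      c * P * (P ^ ((1 + Nr * (B * Nt)) ^ n * (1 + Nr * (B * Nt - J))))⁻¹ ≤
        outageProb 𝒳 B Nr Nt R Q S (n + 1) := by
  obtain ⟨η, hη, hηR⟩ : ∃ η : ℝ, 0 < η ∧ J * (M / B) + (n + 1) * η < R := by
    obtain ⟨η, hη, hlt⟩ := exists_pos_mul_lt (sub_pos.2 hJR) (n + 1)
    exact ⟨η, hη, by linarith⟩
  obtain ⟨A, hA, hlow⟩ := exists_feedback_div_lowInfoProb_le (𝒳 := 𝒳) Nr hB hNt hM R K hη n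
  obtain ⟨c, hc, hstep⟩ :=
    exists_le_real_feedback_accInfo_succ Nr hB hNt hM hη (Nat.sub_le (B * Nt) J)
  refine ⟨c * (A ^ (1 + Nr * (B * Nt - J)))⁻¹, by positivity, fun L P Q S hn hP hav => ?_⟩
  obtain ⟨fb, hr, hx⟩ := hlow L P Q S hn hP hav
  have : 0 < P := one_pos.trans_le hP
  calc _ = c * P * ((A * P ^ ((1 + Nr * (B * Nt)) ^ n)) ^ (1 + Nr * (B * Nt - J)))⁻¹ := by
        rw [mul_pow, ← pow_mul, mul_inv]
        ring
    _ ≤ c * P * ((P / lowInfoProb 𝒳 B Nr Nt R Q S fb (n * η)) ^ (1 + Nr * (B * Nt - J)))⁻¹ := by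
        gcongr
    _ ≤ _ := hstep hn hP hav hr
    _ ≤ _ := by
        refine measureReal_mono fun h hh => hh.2.trans_lt ?_
        rw [Nat.cast_sub hJ, Nat.cast_mul, sub_sub_cancel]
        linarith

end Converse

/-! ## Quantizers with thresholds just below the multiples of a unit -/

/-- The sum of the feedback indices, which is the amount of accumulated information certified by the
feedback `fb` in units of the grid of an `IsGridQuantizer`. -/
def fbSum {K n : ℕ} (fb : Fin n → Fin K) : ℕ := ∑ i, (fb i : ℕ)

lemma fbSum_snoc {K n : ℕ} (fb : Fin n → Fin K) (k : Fin K) :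
    fbSum (Fin.snoc (α := fun _ => Fin K) fb k : Fin (n + 1) → Fin K) = fbSum fb + k := by
  simp [fbSum, Fin.sum_univ_castSucc]

/-- `Q` has its thresholds with index `k ≥ 1` at the points of the grid `u ℕ`, lowered by a margin
that grows by `δ` with every round; the rate `R` still lies below the point `(J + 1) * u` lowered by
the largest margin, and there are enough levels to name the cells `0, …, J`. The threshold with
index `0` is fixed by the laws of `Quantizer`, and rounds after the first `L + 1` are irrelevant.
-/
structure IsGridQuantizer {K : ℕ} (Q : Quantizer K) (R u δ : ℝ) (J L : ℕ) : Prop where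
  unit_nonneg : 0 ≤ u
  margin_nonneg : 0 ≤ δ
  rate_add_le : R + (L + 1) * δ ≤ (J + 1) * u
  add_two_le : J + 2 ≤ K
  thr_eq : ∀ n ≤ L, ∀ (fb : Fin n → Fin K) (k : ℕ), k ≠ 0 →
    Q.thr n fb k = (fbSum fb + k) * u - (n + 1) * δ

section GridThr

variable {K : ℕ} {u : ℝ} {d : ℕ → ℝ}

/-- The thresholds at the multiples of `u`, lowered by `d n` in the round that follows a feedback of
length `n`. -/
def gridThr (K : ℕ) (u : ℝ) (d : ℕ → ℝ) : (n : ℕ) → (Fin n → Fin K) → ℕ → ℝ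
  | 0, _, k => if k = 0 then 0 else k * u - d 0
  | n + 1, fb, k =>
    if k = 0 then gridThr K u d n (Fin.init fb) (fb (Fin.last n))
    else (fbSum fb + k) * u - d (n + 1)

lemma gridThr_of_ne_zero {n : ℕ} (fb : Fin n → Fin K) {k : ℕ} (hk : k ≠ 0) :
    gridThr K u d n fb k = (fbSum fb + k) * u - d n := by
  cases n with
  | zero => simp [gridThr, hk, fbSum]
  | succ n => simp [gridThr, hk]

lemma gridThr_snoc_zero {n : ℕ} (fb : Fin n → Fin K) (k : Fin K) :
    gridThr K u d (n + 1) (Fin.snoc (α := fun _ => Fin K) fb k) 0 = gridThr K u d n fb k := by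
  simp [gridThr]

lemma gridThr_le (hd : ∀ n, 0 ≤ d n) {n : ℕ} (fb : Fin n → Fin K) (k : ℕ) :
    gridThr K u d n fb k ≤ (fbSum fb + k) * u := by
  induction fb using Fin.snocInduction generalizing k with
  | elim0 =>
    rcases eq_or_ne k 0 with rfl | hk
    · simp [gridThr, fbSum]
    · exact (gridThr_of_ne_zero _ hk).trans_le (sub_le_self _ (hd _))
  | snoc fb j ih =>
    rcases eq_or_ne k 0 with rfl | hk
    · rw [gridThr_snoc_zero, fbSum_snoc]
      simpa using ih j
    · exact (gridThr_of_ne_zero _ hk).trans_le (sub_le_self _ (hd _))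

lemma gridThr_lt_succ (hd : ∀ n, 0 ≤ d n) (hdu : ∀ n, d n < u) {n : ℕ} (fb : Fin n → Fin K)
    (k : ℕ) : gridThr K u d n fb k < gridThr K u d n fb (k + 1) := by
  have hu : 0 < u := (hd 0).trans_lt (hdu 0)
  rw [gridThr_of_ne_zero fb k.succ_ne_zero]
  rcases eq_or_ne k 0 with rfl | hk
  · have hle := gridThr_le (u := u) hd fb 0
    push_cast at hle ⊢
    linarith [hdu n]
  · rw [gridThr_of_ne_zero fb hk]
    push_cast
    linarith

end GridThr

lemma exists_isGridQuantizer {K : ℕ} {R u : ℝ} {J : ℕ} (hu : 0 < u) (hR : R < (J + 1) * u)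
    (hK : J + 2 ≤ K) (L : ℕ) :
    ∃ δ : ℝ, 0 < δ ∧ ∃ Q : Quantizer K, IsGridQuantizer Q R u δ J L := by
  obtain ⟨δ, hδ, hlt⟩ := exists_pos_mul_lt (lt_min hu (sub_pos.2 hR)) (L + 1)
  obtain ⟨hlt_unit, hlt_rate⟩ := lt_min_iff.1 hlt
  let d : ℕ → ℝ := fun n => ((min n L : ℕ) + 1) * δ
  have hd : ∀ n, 0 ≤ d n := fun n => by positivity
  have hdu : ∀ n, d n < u := fun n => by
    have : ((min n L : ℕ) : ℝ) ≤ L := by exact_mod_cast min_le_right n L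
    exact (mul_le_mul_of_nonneg_right (by linarith) hδ.le).trans_lt hlt_unit
  let Q : Quantizer K :=
    { thr := gridThr K u d
      thr_first := fun _ => if_pos rfl
      thr_snoc := fun _ fb k _ => gridThr_snoc_zero fb k
      thr_lt := fun _ fb k _ => gridThr_lt_succ hd hdu fb k }
  refine ⟨δ, hδ, Q, hu.le, hδ.le, by linarith, hK, fun n hn fb k hk => ?_⟩
  simp only [Q, gridThr_of_ne_zero fb hk, d, min_eq_left hn]

/-! ## Power rules that grow geometrically with the certified information deficit -/

/-- The exponent of the power that follows the feedback `fb` in `expPowerRule`: round `i` is in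
outage below cell `fb i + 1` with exponent `r * (N - fb i)` per unit of power exponent, and the
power that compensates for this event is larger by the factor `1 + r * (N - fb i)` in the
exponent. -/
def fbExp (r N : ℕ) {K n : ℕ} (fb : Fin n → Fin K) : ℕ := ∏ i, (1 + r * (N - fb i))

lemma fbExp_snoc (r N : ℕ) {K n : ℕ} (fb : Fin n → Fin K) (k : Fin K) :
    fbExp r N (Fin.snoc (α := fun _ => Fin K) fb k : Fin (n + 1) → Fin K) =
      fbExp r N fb * (1 + r * (N - k)) := by
  simp [fbExp, Fin.prod_univ_castSucc]

lemma one_add_mul_mul_one_add_mul_sub_le (r : ℕ) {N J k : ℕ} (hJ : J ≤ N) (hk : k ≤ J) :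
    (1 + r * N) * (1 + r * (N - J)) ≤ (1 + r * (N - (J - k))) * (1 + r * (N - k)) := by
  obtain ⟨t, rfl⟩ := Nat.exists_eq_add_of_le hk
  obtain ⟨s, rfl⟩ := Nat.exists_eq_add_of_le hJ
  have hNJ : k + t + s - (k + t) = s := by lia
  have hNJk : k + t + s - (k + t - k) = k + s := by lia
  have hNk : k + t + s - k = t + s := by lia
  rw [hNJ, hNJk, hNk]
  nlinarith [Nat.zero_le (r * r * (t * k))]

/- Among the ways to accumulate information short of `J + 1` units, receiving it all in the last
round has the smallest outage exponent. -/
lemma pow_mul_one_add_le_fbExp_mul (r : ℕ) {N J K n : ℕ} (hJ : J ≤ N) (fb : Fin n → Fin K)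
    (hfb : fbSum fb ≤ J) :
    (1 + r * N) ^ n * (1 + r * (N - J)) ≤ fbExp r N fb * (1 + r * (N - (J - fbSum fb))) := by
  induction fb using Fin.snocInduction generalizing J with
  | elim0 => simp [fbExp, fbSum]
  | @snoc n fb k ih =>
    rw [fbSum_snoc] at hfb ⊢
    rw [fbExp_snoc]
    have hprefix := ih (J := J - k) (by lia) (by lia)
    have hlast := one_add_mul_mul_one_add_mul_sub_le r hJ (k := k) (by lia)
    calc (1 + r * N) ^ (n + 1) * (1 + r * (N - J))
        = (1 + r * N) ^ n * ((1 + r * N) * (1 + r * (N - J))) := by ring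
      _ ≤ (1 + r * N) ^ n * ((1 + r * (N - (J - k))) * (1 + r * (N - k))) :=
          Nat.mul_le_mul_left _ hlast
      _ = (1 + r * N) ^ n * (1 + r * (N - (J - k))) * (1 + r * (N - k)) := by ring
      _ ≤ fbExp r N fb * (1 + r * (N - (J - k - fbSum fb))) * (1 + r * (N - k)) :=
          Nat.mul_le_mul_right _ hprefix
      _ = _ := by rw [Nat.sub_sub, Nat.add_comm (k : ℕ)]; ring

open Classical in
/-- The rule that spends the power `x ^ fbExp r N fb` after the feedback `fb` unless it contains an
acknowledgment. The absolute value makes the rule total in `x`; only `x > 0` is of interest. -/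
def expPowerRule (r N K : ℕ) [NeZero K] (x : ℝ) : PowerRule K where
  power _ fb := if ∃ i, fb i = ack K then 0 else |x| ^ fbExp r N fb
  power_nonneg _ fb := by
    split_ifs
    · exact le_rfl
    · positivity
  power_ack _ _ h := if_pos h

lemma expPowerRule_power {r N K : ℕ} [NeZero K] {x : ℝ} (hx : 0 < x) {n : ℕ} {fb : Fin n → Fin K}
    (hfb : ¬∃ i, fb i = ack K) : (expPowerRule r N K x).power n fb = x ^ fbExp r N fb := by
  simp only [expPowerRule, if_neg hfb, abs_of_pos hx]

/-! ## Evolution of the feedback before acknowledgment -/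

section Dynamics

variable {𝒳 : Finset ℂ} {B Nr Nt K L J n : ℕ} [NeZero K] {R u δ : ℝ} {Q : Quantizer K}
  {S : PowerRule K}

lemma accInfo_le_succ (h𝒳 : 0 < 𝒳.card) (h : ℕ → RoundGain B Nr Nt) (n : ℕ) :
    accInfo 𝒳 R Q S h n ≤ accInfo 𝒳 R Q S h (n + 1) :=
  le_add_of_nonneg_right (roundInfo_nonneg h𝒳 _ _)

open Classical in
lemma feedbackIndex_val_of_lt (fb : Fin n → Fin K) {a : ℝ} (ha : a < R) :
    (feedbackIndex Q R fb a : ℕ) = Nat.findGreatest (fun k => Q.thr n fb k ≤ a) (K - 2) := by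
  rw [feedbackIndex, if_neg ha.not_ge]

lemma feedbackIndex_ne_ack (hK : 2 ≤ K) (fb : Fin n → Fin K) {a : ℝ} (ha : a < R) :
    feedbackIndex Q R fb a ≠ ack K := by
  classical
  refine Fin.ne_of_val_ne ?_
  rw [feedbackIndex_val_of_lt fb ha, ack]
  have := Nat.findGreatest_le (P := fun k => Q.thr n fb k ≤ a) (K - 2)
  lia

lemma thr_feedbackIndex_le (fb : Fin n → Fin K) {a : ℝ} (ha : a < R)
    (h0 : (feedbackIndex Q R fb a : ℕ) ≠ 0) : Q.thr n fb (feedbackIndex Q R fb a) ≤ a := by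
  classical
  rw [feedbackIndex_val_of_lt fb ha] at h0 ⊢
  exact Nat.findGreatest_of_ne_zero (P := fun k => Q.thr n fb k ≤ a) rfl h0

lemma lt_thr_feedbackIndex_add_one (fb : Fin n → Fin K) {a : ℝ} (ha : a < R)
    (hK : (feedbackIndex Q R fb a : ℕ) < K - 2) : a < Q.thr n fb (feedbackIndex Q R fb a + 1) := by
  classical
  rw [feedbackIndex_val_of_lt fb ha] at hK ⊢
  exact not_le.1 (Nat.findGreatest_is_greatest (P := fun k => Q.thr n fb k ≤ a)
    (Nat.lt_succ_self _) hK)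

lemma feedback_ne_ack (h𝒳 : 0 < 𝒳.card) (hK : 2 ≤ K) (h : ℕ → RoundGain B Nr Nt)
    (ha : accInfo 𝒳 R Q S h n < R) (i : Fin n) : feedback 𝒳 R Q S h n i ≠ ack K := by
  induction n with
  | zero => exact i.elim0
  | succ n ih =>
    rw [feedback_succ]
    refine Fin.lastCases ?_ (fun i => ?_) i
    · rw [Fin.snoc_last]
      exact feedbackIndex_ne_ack hK _ ha
    · rw [Fin.snoc_castSucc]
      exact ih ((accInfo_le_succ h𝒳 h n).trans_lt ha) i

lemma accInfo_lt_of_feedback_ne_ack (hR : 0 < R) (h : ℕ → RoundGain B Nr Nt)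
    (hfb : ¬∃ i, feedback 𝒳 R Q S h n i = ack K) : accInfo 𝒳 R Q S h n < R := by
  cases n with
  | zero => exact hR
  | succ n =>
    by_contra! hn
    refine hfb ⟨Fin.last n, ?_⟩
    rw [feedback_succ, Fin.snoc_last, feedbackIndex, if_pos hn]

lemma IsGridQuantizer.fbSum_mul_le (hQ : IsGridQuantizer Q R u δ J L) (h𝒳 : 0 < 𝒳.card)
    (hn : n ≤ L) (h : ℕ → RoundGain B Nr Nt) (ha : accInfo 𝒳 R Q S h n < R) :
    fbSum (feedback 𝒳 R Q S h n) * u ≤ accInfo 𝒳 R Q S h n + n * δ := by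
  have hδ := hQ.margin_nonneg
  induction n with
  | zero => simp [fbSum, accInfo_zero]
  | succ n ih =>
    have hmono := accInfo_le_succ (R := R) (Q := Q) (S := S) h𝒳 h n
    rw [feedback_succ, fbSum_snoc]
    by_cases h0 : (feedbackIndex Q R (feedback 𝒳 R Q S h n) (accInfo 𝒳 R Q S h (n + 1)) : ℕ) = 0
    · have hprev := ih (by lia) (hmono.trans_lt ha)
      rw [h0, add_zero]
      push_cast
      linarith
    · have hthr := thr_feedbackIndex_le _ ha h0
      rw [hQ.thr_eq n (by lia) _ _ h0] at hthr
      push_cast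
      linarith

lemma IsGridQuantizer.fbSum_le (hQ : IsGridQuantizer Q R u δ J L) (h𝒳 : 0 < 𝒳.card)
    (hn : n ≤ L) (h : ℕ → RoundGain B Nr Nt) (ha : accInfo 𝒳 R Q S h n < R) :
    fbSum (feedback 𝒳 R Q S h n) ≤ J := by
  have hsum := hQ.fbSum_mul_le h𝒳 hn h ha
  have hmargin : (n : ℝ) * δ ≤ (L + 1) * δ :=
    mul_le_mul_of_nonneg_right (by exact_mod_cast hn.trans L.le_succ) hQ.margin_nonneg
  have hlt : (fbSum (feedback 𝒳 R Q S h n) : ℝ) < (J + 1 : ℕ) := by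
    refine lt_of_mul_lt_mul_right ?_ hQ.unit_nonneg
    push_cast
    linarith [hQ.rate_add_le]
  exact Nat.lt_succ_iff.1 (by exact_mod_cast hlt)

lemma IsGridQuantizer.accInfo_succ_lt (hQ : IsGridQuantizer Q R u δ J L) (hn : n ≤ L)
    (h : ℕ → RoundGain B Nr Nt) (ha : accInfo 𝒳 R Q S h (n + 1) < R) :
    accInfo 𝒳 R Q S h (n + 1) <
      (fbSum (feedback 𝒳 R Q S h (n + 1)) + 1) * u - (n + 1) * δ := by
  rw [feedback_succ, fbSum_snoc]
  set fb := feedback 𝒳 R Q S h n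
  set k := feedbackIndex Q R fb (accInfo 𝒳 R Q S h (n + 1)) with hk
  rcases lt_or_ge (k : ℕ) (K - 2) with hlt | hge
  · have hthr := lt_thr_feedbackIndex_add_one fb ha hlt
    rw [← hk, hQ.thr_eq n hn fb _ (k : ℕ).succ_ne_zero] at hthr
    push_cast at hthr ⊢
    linarith
  · have hJ : (J : ℝ) ≤ (fbSum fb + k : ℕ) := by
      have := hQ.add_two_le
      exact_mod_cast (by lia : J ≤ fbSum fb + k)
    have hmargin : ((n : ℝ) + 1) * δ ≤ (L + 1) * δ :=
      mul_le_mul_of_nonneg_right (by exact_mod_cast Nat.succ_le_succ hn) hQ.margin_nonneg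
    have hunit : ((J : ℝ) + 1) * u ≤ ((fbSum fb + k : ℕ) + 1) * u :=
      mul_le_mul_of_nonneg_right (by linarith) hQ.unit_nonneg
    linarith [hQ.rate_add_le]

lemma IsGridQuantizer.roundInfo_lt_of_feedback_succ (hQ : IsGridQuantizer Q R u δ J L)
    (h𝒳 : 0 < 𝒳.card) (hn : n ≤ L) (h : ℕ → RoundGain B Nr Nt) {fb : Fin n → Fin K} {k : Fin K}
    (hfb : feedback 𝒳 R Q S h (n + 1) = Fin.snoc (α := fun _ => Fin K) fb k)
    (ha : accInfo 𝒳 R Q S h (n + 1) < R) :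
    (feedback 𝒳 R Q S h n = fb ∧ accInfo 𝒳 R Q S h n < R) ∧
      roundInfo 𝒳 (S.power n fb) (h n) < ((k : ℕ) + 1) * u - δ := by
  obtain rfl : feedback 𝒳 R Q S h n = fb := (Fin.snoc_injective2 (hfb ▸ (feedback_succ h n).symm)).1
  have ha' := (accInfo_le_succ h𝒳 h n).trans_lt ha
  have hlow := hQ.fbSum_mul_le h𝒳 hn h ha'
  have hup := hQ.accInfo_succ_lt hn h ha
  rw [hfb, fbSum_snoc, accInfo_succ] at hup
  push_cast at hup
  exact ⟨⟨rfl, ha'⟩, by linarith⟩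

lemma IsGridQuantizer.roundInfo_lt_of_accInfo_succ_lt (hQ : IsGridQuantizer Q R u δ J L)
    (h𝒳 : 0 < 𝒳.card) (hn : n ≤ L) (h : ℕ → RoundGain B Nr Nt)
    (ha : accInfo 𝒳 R Q S h (n + 1) < R) :
    roundInfo 𝒳 (S.power n (feedback 𝒳 R Q S h n)) (h n) <
      ((J - fbSum (feedback 𝒳 R Q S h n) : ℕ) + 1) * u - δ := by
  have ha' := (accInfo_le_succ h𝒳 h n).trans_lt ha
  have hlow := hQ.fbSum_mul_le h𝒳 hn h ha'
  have hmargin : ((n : ℝ) + 1) * δ ≤ (L + 1) * δ :=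
    mul_le_mul_of_nonneg_right (by exact_mod_cast Nat.succ_le_succ hn) hQ.margin_nonneg
  rw [Nat.cast_sub (hQ.fbSum_le h𝒳 hn h ha')]
  rw [accInfo_succ] at ha
  linarith [hQ.rate_add_le]

end Dynamics

/-! ## Achievability -/

/-- The information of one round falls below `i + 1` units of size `u`, lowered by the margin `δ`,
with an outage exponent of at least `r * (N - i)` and the common constant `C`. -/
def RoundTailBound (𝒳 : Finset ℂ) (B Nr Nt r N : ℕ) (u δ C : ℝ) : Prop :=
  ∀ p : ℝ, 0 < p → ∀ i : ℕ, (roundLaw B Nr Nt).real {h | roundInfo 𝒳 p h < (i + 1) * u - δ} ≤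
    C * (p ^ (r * (N - i)))⁻¹

/-- The probability that the feedback vector is `fb` while the rate is not yet reached. -/
def activeProb (𝒳 : Finset ℂ) (B Nr Nt : ℕ) {K : ℕ} [NeZero K] (R : ℝ) (Q : Quantizer K)
    (S : PowerRule K) {n : ℕ} (fb : Fin n → Fin K) : ℝ :=
  (fadingLaw B Nr Nt).real {h | feedback 𝒳 R Q S h n = fb ∧ accInfo 𝒳 R Q S h n < R}

section Achievability

variable {𝒳 : Finset ℂ} {B Nr Nt r N K L J n : ℕ} [NeZero K] {R u δ C x : ℝ} {Q : Quantizer K}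
  {S : PowerRule K}

lemma RoundTailBound.const_nonneg (hT : RoundTailBound 𝒳 B Nr Nt r N u δ C) : 0 ≤ C := by
  simpa using measureReal_nonneg.trans (hT 1 one_pos 0)

lemma fadingLaw_real_active_inter (fb : Fin n → Fin K) {T : Set (RoundGain B Nr Nt)}
    (hT : MeasurableSet T) :
    (fadingLaw B Nr Nt).real {h | (feedback 𝒳 R Q S h n = fb ∧ accInfo 𝒳 R Q S h n < R) ∧ h n ∈ T} =
      activeProb 𝒳 B Nr Nt R Q S fb * (roundLaw B Nr Nt).real T :=
  fadingLaw_real_state_inter (E := {p : (Fin n → Fin K) × ℝ | p.1 = fb ∧ p.2 < R})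
    ((measurableSet_singleton fb).prod measurableSet_Iio) hT

lemma activeProb_eq_zero_of_ack (h𝒳 : 0 < 𝒳.card) (hK : 2 ≤ K) {fb : Fin n → Fin K}
    (hfb : ∃ i, fb i = ack K) : activeProb 𝒳 B Nr Nt R Q S fb = 0 := by
  obtain ⟨i, hi⟩ := hfb
  have hempty : {h : ℕ → RoundGain B Nr Nt | feedback 𝒳 R Q S h n = fb ∧
      accInfo 𝒳 R Q S h n < R} = ∅ := by
    refine Set.eq_empty_of_forall_notMem ?_
    rintro h ⟨rfl, ha⟩
    exact feedback_ne_ack h𝒳 hK h ha i hi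
  rw [activeProb, hempty, measureReal_empty]

lemma RoundTailBound.real_active_roundInfo_lt_mul_le (hT : RoundTailBound 𝒳 B Nr Nt r N u δ C)
    (h𝒳 : 0 < 𝒳.card) (hK : 2 ≤ K) (hx : 0 < x) (hS : S = expPowerRule r N K x)
    (fb : Fin n → Fin K) (i : ℕ) :
    (fadingLaw B Nr Nt).real {h | (feedback 𝒳 R Q S h n = fb ∧ accInfo 𝒳 R Q S h n < R) ∧
      roundInfo 𝒳 (S.power n fb) (h n) < (i + 1) * u - δ} *
        x ^ (fbExp r N fb * (1 + r * (N - i))) ≤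
      C * (activeProb 𝒳 B Nr Nt R Q S fb * x ^ fbExp r N fb) := by
  have hind := fadingLaw_real_active_inter (𝒳 := 𝒳) (R := R) (Q := Q) (S := S) fb
    (measurable_roundInfo (B := B) (Nr := Nr) (Nt := Nt) 𝒳 (S.power n fb)
      (measurableSet_Iio (a := (i + 1) * u - δ)))
  refine (congrArg (· * _) hind).trans_le ?_
  by_cases hfb : ∃ i, fb i = ack K
  · simp [activeProb_eq_zero_of_ack h𝒳 hK hfb]
  have hpower : S.power n fb = x ^ fbExp r N fb := by rw [hS, expPowerRule_power hx hfb]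
  rw [hpower, pow_mul]
  set y := x ^ fbExp r N fb
  have hy : 0 < y := by positivity
  have hm : 0 ≤ activeProb 𝒳 B Nr Nt R Q S fb := measureReal_nonneg
  calc _ ≤ activeProb 𝒳 B Nr Nt R Q S fb * (C * (y ^ (r * (N - i)))⁻¹) * y ^ (1 + r * (N - i)) := by
        gcongr
        exact hT y hy i
    _ = C * (activeProb 𝒳 B Nr Nt R Q S fb * y) := by
        rw [pow_add, pow_one]
        field_simp

lemma RoundTailBound.activeProb_mul_pow_le (hT : RoundTailBound 𝒳 B Nr Nt r N u δ C)
    (hQ : IsGridQuantizer Q R u δ J L) (h𝒳 : 0 < 𝒳.card) (hx : 0 < x)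
    (hS : S = expPowerRule r N K x) (hn : n ≤ L) (fb : Fin n → Fin K) :
    activeProb 𝒳 B Nr Nt R Q S fb * x ^ fbExp r N fb ≤ C ^ n * x := by
  have hK : 2 ≤ K := by have := hQ.add_two_le; lia
  induction fb using Fin.snocInduction with
  | elim0 =>
    simp only [fbExp, Finset.univ_eq_empty, Finset.prod_empty, pow_one, pow_zero]
    exact mul_le_mul_of_nonneg_right measureReal_le_one hx.le
  | @snoc n fb k ih =>
    rw [fbExp_snoc]
    calc _ ≤ _ := mul_le_mul_of_nonneg_right (measureReal_mono fun h hh =>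
          hQ.roundInfo_lt_of_feedback_succ h𝒳 (by lia) h hh.1 hh.2) (by positivity)
      _ ≤ C * (activeProb 𝒳 B Nr Nt R Q S fb * x ^ fbExp r N fb) :=
          hT.real_active_roundInfo_lt_mul_le h𝒳 hK hx hS fb k
      _ ≤ C * (C ^ n * x) := mul_le_mul_of_nonneg_left (ih (by lia)) hT.const_nonneg
      _ = C ^ (n + 1) * x := by ring

lemma RoundTailBound.feedbackProb_mul_power_le (hT : RoundTailBound 𝒳 B Nr Nt r N u δ C)
    (hQ : IsGridQuantizer Q R u δ J L) (h𝒳 : 0 < 𝒳.card) (hR : 0 < R) (hx : 0 < x)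
    (hS : S = expPowerRule r N K x) (hn : n ≤ L) (fb : Fin n → Fin K) :
    feedbackProb 𝒳 B Nr Nt R Q S fb * S.power n fb ≤ C ^ n * x := by
  have hC := hT.const_nonneg
  by_cases hfb : ∃ i, fb i = ack K
  · rw [S.power_ack _ _ hfb, mul_zero]
    positivity
  · have hactive : feedbackProb 𝒳 B Nr Nt R Q S fb ≤ activeProb 𝒳 B Nr Nt R Q S fb := by
      refine measureReal_mono ?_
      rintro h rfl
      exact ⟨rfl, accInfo_lt_of_feedback_ne_ack hR h hfb⟩
    have hpower : S.power n fb = x ^ fbExp r N fb := by rw [hS, expPowerRule_power hx hfb]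
    rw [hpower]
    exact (mul_le_mul_of_nonneg_right hactive (by positivity)).trans
      (hT.activeProb_mul_pow_le hQ h𝒳 hx hS hn fb)

lemma RoundTailBound.averagePower_le (hT : RoundTailBound 𝒳 B Nr Nt r N u δ C)
    (hQ : IsGridQuantizer Q R u δ J L) (h𝒳 : 0 < 𝒳.card) (hR : 0 < R) (hx : 0 < x)
    (hS : S = expPowerRule r N K x) :
    averagePower 𝒳 B Nr Nt R Q S L ≤ (∑ n ∈ Finset.range L, (K : ℝ) ^ n * C ^ n) * x := by
  rw [averagePower, Finset.sum_mul]
  refine Finset.sum_le_sum fun n hn => ?_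
  calc _ ≤ ∑ _fb : Fin n → Fin K, C ^ n * x := Finset.sum_le_sum fun fb _ =>
        hT.feedbackProb_mul_power_le hQ h𝒳 hR hx hS (Finset.mem_range.1 hn).le fb
    _ = _ := by simp [mul_assoc]

lemma RoundTailBound.real_feedback_outage_le (hT : RoundTailBound 𝒳 B Nr Nt r N u δ C)
    (hQ : IsGridQuantizer Q R u δ J L) (h𝒳 : 0 < 𝒳.card) (hJ : J ≤ N) (hx : 1 ≤ x)
    (hS : S = expPowerRule r N K x) (hn : n ≤ L) (fb : Fin n → Fin K) :
    (fadingLaw B Nr Nt).real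
        {h | feedback 𝒳 R Q S h n = fb ∧ accInfo 𝒳 R Q S h (n + 1) < R} ≤
      C ^ (n + 1) * (x * (x ^ ((1 + r * N) ^ n * (1 + r * (N - J))))⁻¹) := by
  have hx0 : 0 < x := one_pos.trans_le hx
  have hC := hT.const_nonneg
  have hK : 2 ≤ K := by have := hQ.add_two_le; lia
  rcases Set.eq_empty_or_nonempty
    {h : ℕ → RoundGain B Nr Nt | feedback 𝒳 R Q S h n = fb ∧ accInfo 𝒳 R Q S h (n + 1) < R}
    with hempty | ⟨h, hfb, ha⟩
  · rw [hempty, measureReal_empty]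
    positivity
  have hsum : fbSum fb ≤ J := hfb ▸ hQ.fbSum_le h𝒳 hn h ((accInfo_le_succ h𝒳 h n).trans_lt ha)
  rw [← mul_assoc, ← div_eq_mul_inv, le_div_iff₀ (by positivity)]
  calc _ ≤ _ := mul_le_mul_of_nonneg_left (pow_le_pow_right₀ hx
        (pow_mul_one_add_le_fbExp_mul r hJ fb hsum)) measureReal_nonneg
    _ ≤ _ := by
        refine mul_le_mul_of_nonneg_right (measureReal_mono ?_) (by positivity)
        rintro h ⟨rfl, ha⟩
        exact ⟨⟨rfl, (accInfo_le_succ h𝒳 h n).trans_lt ha⟩,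
          hQ.roundInfo_lt_of_accInfo_succ_lt h𝒳 hn h ha⟩
    _ ≤ C * (activeProb 𝒳 B Nr Nt R Q S fb * x ^ fbExp r N fb) :=
        hT.real_active_roundInfo_lt_mul_le h𝒳 hK hx0 hS fb (J - fbSum fb)
    _ ≤ C * (C ^ n * x) :=
        mul_le_mul_of_nonneg_left (hT.activeProb_mul_pow_le hQ h𝒳 hx0 hS hn fb) hC
    _ = C ^ (n + 1) * x := by ring

lemma RoundTailBound.outageProb_le (hT : RoundTailBound 𝒳 B Nr Nt r N u δ C)
    (hQ : IsGridQuantizer Q R u δ J L) (h𝒳 : 0 < 𝒳.card) (hJ : J ≤ N) (hx : 1 ≤ x)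
    (hS : S = expPowerRule r N K x) (hn : n ≤ L) :
    outageProb 𝒳 B Nr Nt R Q S (n + 1) ≤ (K : ℝ) ^ n * C ^ (n + 1) *
      (x * (x ^ ((1 + r * N) ^ n * (1 + r * (N - J))))⁻¹) := by
  calc _ ≤ (fadingLaw B Nr Nt).real (⋃ fb : Fin n → Fin K,
        {h | feedback 𝒳 R Q S h n = fb ∧ accInfo 𝒳 R Q S h (n + 1) < R}) :=
        measureReal_mono fun h hh => Set.mem_iUnion.2 ⟨_, rfl, hh⟩
    _ ≤ _ := measureReal_iUnion_fintype_le _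
    _ ≤ ∑ _fb : Fin n → Fin K,
        C ^ (n + 1) * (x * (x ^ ((1 + r * N) ^ n * (1 + r * (N - J))))⁻¹) :=
        Finset.sum_le_sum fun fb _ => hT.real_feedback_outage_le hQ h𝒳 hJ hx hS hn fb
    _ = _ := by simp [mul_assoc]

end Achievability

/-! ## Outage exponents -/

lemma neg_log_const_mul_div {c : ℝ} (hc : 0 < c) (E : ℕ) {P : ℝ} (hP : 1 < P) :
    -Real.log (c * P * (P ^ E)⁻¹) / Real.log P = ((E : ℝ) - 1) - Real.log c / Real.log P := by
  have hlog : 0 < Real.log P := Real.log_pos hP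
  have hP0 : 0 < P := one_pos.trans hP
  rw [Real.log_mul (by positivity) (by positivity), Real.log_mul hc.ne' hP0.ne', Real.log_inv,
    Real.log_pow]
  field_simp
  ring

lemma tendsto_exponent_of_bounds {c C : ℝ} (hc : 0 < c) (hC : 0 < C) (E : ℕ) {f : ℝ → ℝ}
    (hlow : ∀ᶠ P in atTop, c * P * (P ^ E)⁻¹ ≤ f P)
    (hup : ∀ᶠ P in atTop, f P ≤ C * P * (P ^ E)⁻¹) :
    Tendsto (fun P => -Real.log (f P) / Real.log P) atTop (𝓝 ((E : ℝ) - 1)) := by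
  have hlim (a : ℝ) : Tendsto (fun P => ((E : ℝ) - 1) - Real.log a / Real.log P) atTop
      (𝓝 ((E : ℝ) - 1)) := by
    simpa only [sub_zero] using (tendsto_const_nhds (x := (E : ℝ) - 1)).sub
      (Tendsto.const_div_atTop Real.tendsto_log_atTop (Real.log a))
  refine tendsto_of_tendsto_of_tendsto_of_le_of_le' (hlim C) (hlim c) ?_ ?_
  · filter_upwards [hlow, hup, eventually_gt_atTop 1] with P hlow hup hP
    have : 0 < P := one_pos.trans hP
    have : 0 < Real.log P := Real.log_pos hP
    have : 0 < f P := lt_of_lt_of_le (by positivity) hlow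
    rw [← neg_log_const_mul_div hC E hP]
    gcongr
  · filter_upwards [hlow, eventually_gt_atTop 1] with P hlow hP
    have : 0 < P := one_pos.trans hP
    have : 0 < Real.log P := Real.log_pos hP
    rw [← neg_log_const_mul_div hc E hP]
    gcongr

lemma exists_nat_lt_lt_add_one {x : ℝ} (hx : 0 ≤ x) (hint : ∀ z : ℤ, x ≠ z) :
    ∃ J : ℕ, J < x ∧ x < J + 1 :=
  ⟨⌊x⌋₊, (Nat.floor_le hx).lt_of_ne' (by exact_mod_cast hint ⌊x⌋₊), Nat.lt_floor_add_one x⟩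

lemma mul_div_lt_iff_lt_mul_div {b m R a : ℝ} (hb : 0 < b) (hm : 0 < m) :
    a * (m / b) < R ↔ a < b * R / m := by
  rw [← mul_div_assoc, div_lt_iff₀ hb, lt_div_iff₀ hm, mul_comm R]

lemma lt_mul_div_iff_mul_div_lt {b m R a : ℝ} (hb : 0 < b) (hm : 0 < m) :
    R < a * (m / b) ↔ b * R / m < a := by
  rw [← mul_div_assoc, lt_div_iff₀ hb, div_lt_iff₀ hm, mul_comm R]

lemma arqDiversity_add_one_eq {B Nr Nt J : ℕ} {M R : ℝ} (hJ : J ≤ B * Nt)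
    (hJR : (J : ℝ) < B * R / M) (hRJ : B * R / M < J + 1) (n : ℕ) :
    arqDiversity B Nr Nt M R (n + 1) =
      (((1 + Nr * (B * Nt)) ^ n * (1 + Nr * (B * Nt - J)) : ℕ) : ℝ) - 1 := by
  have hfloor : ⌊(B : ℝ) * (Nt - R / M)⌋ = (B * Nt : ℤ) - J - 1 := by
    rw [Int.floor_eq_iff, mul_sub, ← mul_div_assoc]
    push_cast
    constructor <;> linarith
  rw [arqDiversity, singletonDiversity, hfloor]
  push_cast [Nat.cast_sub hJ]
  ring

/-! ## Optimal systems -/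

section Optimal

variable {𝒳 : Finset ℂ} {B Nr Nt K L J : ℕ} [NeZero K] {R M P : ℝ} {Q : Quantizer K}
  {S : PowerRule K}

lemma optimalOutageProb_le (hav : averagePower 𝒳 B Nr Nt R Q S L ≤ P) (l : ℕ) :
    optimalOutageProb 𝒳 B Nr Nt K R L l P ≤ outageProb 𝒳 B Nr Nt R Q S l := by
  refine csInf_le ⟨0, ?_⟩ ⟨Q, S, hav, rfl⟩
  rintro _ ⟨Q, S, -, rfl⟩
  exact measureReal_nonneg

lemma le_optimalOutageProb {l : ℕ} {p : ℝ} (hav : averagePower 𝒳 B Nr Nt R Q S L ≤ P)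
    (hp : ∀ (Q : Quantizer K) (S : PowerRule K), averagePower 𝒳 B Nr Nt R Q S L ≤ P →
      p ≤ outageProb 𝒳 B Nr Nt R Q S l) :
    p ≤ optimalOutageProb 𝒳 B Nr Nt K R L l P := by
  refine le_csInf ⟨_, Q, S, hav, rfl⟩ ?_
  rintro _ ⟨Q, S, hav, rfl⟩
  exact hp Q S hav

lemma exists_system_outageProb_le (Nr L : ℕ) (hB : 0 < B) (hNt : 0 < Nt)
    (hM : (𝒳.card : ℝ) = (2 : ℝ) ^ M) (hM0 : 0 < M) (hR : 0 < R) (hJ : J ≤ B * Nt)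
    (hRJ : R < (J + 1) * (M / B)) (hK : J + 2 ≤ K) :
    ∃ (Q : Quantizer K) (S : ℝ → PowerRule K),
      (∀ P : ℝ, 0 < P → averagePower 𝒳 B Nr Nt R Q (S P) L ≤ P) ∧
      ∀ n < L, ∃ C : ℝ, 0 < C ∧ ∀ᶠ P in atTop, outageProb 𝒳 B Nr Nt R Q (S P) (n + 1) ≤
        C * P * (P ^ ((1 + Nr * (B * Nt)) ^ n * (1 + Nr * (B * Nt - J))))⁻¹ := by
  have h𝒳 := card_pos_of_eq_two_rpow hM
  have hu : 0 < M / B := by positivity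
  obtain ⟨δ, hδ, Q, hQ⟩ := exists_isGridQuantizer hu hRJ hK L
  obtain ⟨C, hC, hT⟩ : ∃ C ≥ 1, RoundTailBound 𝒳 B Nr Nt Nr (B * Nt) (M / B) δ C :=
    exists_roundLaw_roundInfo_lt_le Nr hB hNt hM hM0 hδ
  have : 0 < C := one_pos.trans_le hC
  have : (0 : ℝ) < K := by exact_mod_cast NeZero.pos K
  set σ : ℝ := ∑ n ∈ Finset.range L, (K : ℝ) ^ n * C ^ n
  have hσ : 0 < σ + 1 := by positivity
  refine ⟨Q, fun P => expPowerRule Nr (B * Nt) K (P / (σ + 1)), fun P hP => ?_, fun n hn => ?_⟩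
  · calc _ ≤ σ * (P / (σ + 1)) := hT.averagePower_le hQ h𝒳 hR (by positivity) rfl
      _ ≤ (σ + 1) * (P / (σ + 1)) := by gcongr; linarith
      _ = P := mul_div_cancel₀ P hσ.ne'
  · set E := (1 + Nr * (B * Nt)) ^ n * (1 + Nr * (B * Nt - J))
    refine ⟨K ^ n * C ^ (n + 1) * ((σ + 1)⁻¹ * (σ + 1) ^ E), by positivity, ?_⟩
    filter_upwards [eventually_ge_atTop (σ + 1)] with P hP
    refine (hT.outageProb_le hQ h𝒳 hJ ((one_le_div hσ).2 hP) rfl hn.le).trans_eq ?_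
    rw [div_pow, inv_div]
    ring

end Optimal

end INRARQ

end

open INRARQ in
theorem theorem2_general
    (B Nr Nt L K : ℕ) (hB : 0 < B) (hNt : 0 < Nt) [NeZero K]
    (𝒳 : Finset ℂ) (M : ℝ) (hM : (𝒳.card : ℝ) = (2 : ℝ) ^ M)
    (R : ℝ) (hR : 0 < R) (hRM : R < M * Nt)
    (hint : ∀ z : ℤ, (B : ℝ) * R / M ≠ z)
    (hK : ⌈(B : ℝ) * R / M⌉₊ + 1 ≤ K) :
    (∀ l : ℕ, 1 ≤ l → l ≤ L →
      Tendsto (fun P : ℝ => -Real.log (optimalOutageProb 𝒳 B Nr Nt K R L l P) / Real.log P)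
        atTop (𝓝 (arqDiversity B Nr Nt M R l))) ∧
    (∃ (Q : Quantizer K) (S : ℝ → PowerRule K),
      (∀ P : ℝ, 0 < P → averagePower 𝒳 B Nr Nt R Q (S P) L ≤ P) ∧
      ∀ l : ℕ, 1 ≤ l → l ≤ L →
        Tendsto (fun P : ℝ => -Real.log (outageProb 𝒳 B Nr Nt R Q (S P) l) / Real.log P)
          atTop (𝓝 (arqDiversity B Nr Nt M R l))) := by
  have hM0 : 0 < M := pos_of_mul_pos_left (hR.trans hRM) Nt.cast_nonneg
  have hB0 : (0 : ℝ) < B := by exact_mod_cast hB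
  obtain ⟨J, hJR, hRJ⟩ := exists_nat_lt_lt_add_one (by positivity) hint
  have hJ : J ≤ B * Nt := by
    have hlt : (B : ℝ) * R / M < B * Nt := by rw [div_lt_iff₀ hM0]; nlinarith
    exact_mod_cast (hJR.trans hlt).le
  have hJK : J + 2 ≤ K := by have := Nat.lt_ceil.2 hJR; lia
  obtain ⟨Q, S, hav, hup⟩ := exists_system_outageProb_le Nr L hB hNt hM hM0 hR hJ
    ((lt_mul_div_iff_mul_div_lt hB0 hM0).2 hRJ) hJK
  have hlow := exists_le_outageProb (𝒳 := 𝒳) Nr hB hNt hM K hJ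
    ((mul_div_lt_iff_lt_mul_div hB0 hM0).2 hJR)
  refine ⟨fun l hl hlL => ?_, Q, S, hav, fun l hl hlL => ?_⟩ <;>
    obtain ⟨n, rfl⟩ := Nat.exists_eq_add_of_le' hl <;>
    obtain ⟨c, hc, hlow⟩ := hlow n <;>
    obtain ⟨C, hC, hup⟩ := hup n hlL <;>
    rw [arqDiversity_add_one_eq hJ hJR hRJ n] <;>
    refine tendsto_exponent_of_bounds hc hC _ ?_ ?_
  · filter_upwards [eventually_ge_atTop 1] with P hP using
      le_optimalOutageProb (hav P (one_pos.trans_le hP)) fun Q S => hlow L P Q S hlL hP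
  · filter_upwards [hup, eventually_gt_atTop 0] with P hup hP using
      (optimalOutageProb_le (hav P hP) _).trans hup
  · filter_upwards [eventually_ge_atTop 1] with P hP using
      hlow L P Q (S P) hlL hP (hav P (one_pos.trans_le hP))
  · exact hup

theorem theorem2
    -- numbers of blocks, receive and transmit antennas, rounds, feedback levels
    (B Nr Nt L K : ℕ) (hB : 0 < B) (hNr : 0 < Nr) (hNt : 0 < Nt) [NeZero K]
    -- the constellation: size `2 ^ M`, unit average energy
    (𝒳 : Finset ℂ) (M : ℝ) (hM : (𝒳.card : ℝ) = (2 : ℝ) ^ M)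
    (henergy : (𝒳.card : ℝ)⁻¹ * ∑ x ∈ 𝒳, ‖x‖ ^ 2 = 1)
    -- the rate
    (R : ℝ) (hR : 0 < R) (hRM : R < M * Nt)
    (hint : ∀ z : ℤ, (B : ℝ) * R / M ≠ z)
    (hK : ⌈(B : ℝ) * R / M⌉₊ + 1 ≤ K) :
    -- optimality: the exponent of the least outage probability at each round
    (∀ l : ℕ, 1 ≤ l → l ≤ L →
      Tendsto
        (fun P : ℝ => -Real.log (INRARQ.optimalOutageProb 𝒳 B Nr Nt K R L l P) / Real.log P)
        atTop (𝓝 (INRARQ.arqDiversity B Nr Nt M R l))) ∧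
    -- achievability: one choice of thresholds and power rules attains it at all rounds
    (∃ (Q : INRARQ.Quantizer K) (S : ℝ → INRARQ.PowerRule K),
      (∀ P : ℝ, 0 < P → INRARQ.averagePower 𝒳 B Nr Nt R Q (S P) L ≤ P) ∧
      ∀ l : ℕ, 1 ≤ l → l ≤ L →
        Tendsto
          (fun P : ℝ => -Real.log (INRARQ.outageProb 𝒳 B Nr Nt R Q (S P) l) / Real.log P)
          atTop (𝓝 (INRARQ.arqDiversity B Nr Nt M R l))) :=
  theorem2_general B Nr Nt L K hB hNt 𝒳 M hM R hR hRM hint hK
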